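/- **Conventions.** Manifolds are real, finite-dimensional, $C^\infty$, Hausdorff and second countable. For a smooth 2-form $\Omega$ of constant-rank kernel on a manifold $N$, $N/\ker\Omega$ is the space of leaves of the foliation $\ker\Omega$ (two points are in the same leaf iff they are joined by a piecewise smooth curve tangent to $\ker\Omega$), with canonical projection $\pi:N\to N/\ker\Omega$. Whenever such a quotient occurs below, it is assumed to be a manifold in such a way that $\pi$ is a submersion with $\ker T_x\pi=\ker\Omega_x$ for all $x$. **Data.** Let $M$ be a connected manifold, $\Omega$ a presymplectic form on $M$ (closed 2-form of constant rank) and $H\in C^\infty(M)$ such that $i(X)\Omega=dH$ has a solution $X\in\mathfrak X(M)$. Let $G$ be a connected Lie group with Lie algebra $\mathfrak g$, acting smoothly, freely and properly on $M$ by maps $\Phi_g$ with $\Phi_g^*\Omega=\Omega$ and $\Phi_g^*H=H$; $\tilde\xi$ denotes the fundamental vector field of $\xi\in\mathfrak g$. The action is Poissonian with momentum map $J:M\to\mathfrak g^*$: the functions $f_\xi=\langle J,\xi\rangle$ are smooth, $i(\tilde\xi)\Omega=df_\xi$ and $f_{[\xi,\eta]}=\Omega(\tilde\xi,\tilde\eta)$.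 Let $\mathbf G\subset\mathfrak g$ be a subalgebra such that every smooth vector field in $\ker\Omega$ is a finite sum $\sum_i f^i\tilde\xi_i$ with $f^i\in C^\infty(M)$, $\xi_i\in\mathbf G$. Assume that the connected subgroup $\mathcal G\subset G$ with Lie algebra $\mathbf G$ is closed and normal, and let $\bar G=G/\mathcal G$ be the quotient Lie group, $\mathfrak g_{\bar M}$ its Lie algebra and $\mathrm{pr}:\mathfrak g\to\mathfrak g_{\bar M}$ the projection. *Gauge reduction.* Let $\bar M=M/\ker\Omega$ with projection $\pi_M$, let $\bar\omega$ be a symplectic form on $\bar M$ with $\pi_M^*\bar\omega=\Omega$, and $\bar H\in C^\infty(\bar M)$ with $\pi_M^*\bar H=H$. Assume that the reduced action descends to $\bar G$, i.e. $\bar G$ acts on $\bar M$ with $\bar\Phi_{g\mathcal G}(\pi_M(x))=\pi_M(\Phi_g(x))$, and that $J$ induces the reduced momentum map $\bar J:\bar M\to\mathfrak g_{\bar M}^*$, $\langle\bar J(\pi_M(x)),\mathrm{pr}(\xi)\rangle=\langle J(x),\xi\rangle$. Let $\bar\mu\in\mathfrak g_{\bar M}^*$ and $\mu=\bar\mu\circ\mathrm{pr}\in\mathfrak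 g^*$ be weakly regular values of $\bar J$ and $J$: the level sets are embedded submanifolds $j_{\bar\mu}:\bar J^{-1}(\bar\mu)\hookrightarrow\bar M$ and $j_\mu:J^{-1}(\mu)\hookrightarrow M$ whose tangent spaces are the kernels of the tangent maps of $\bar J$ and $J$. Put $\Omega_\mu=j_\mu^*\Omega$, $H_\mu=j_\mu^*H$, $\omega_{\bar\mu}=j_{\bar\mu}^*\bar\omega$, $H_{\bar\mu}=j_{\bar\mu}^*\bar H$, and let $\pi_\mu$, $\pi_{\bar\mu}$ be the projections of $J^{-1}(\mu)$ onto $J^{-1}(\mu)/\ker\Omega_\mu$ and of $\bar J^{-1}(\bar\mu)$ onto $\bar J^{-1}(\bar\mu)/\ker\omega_{\bar\mu}$. **Theorem.** At every point of $J^{-1}(\mu)$ (resp. $\bar J^{-1}(\bar\mu)$), $\ker\Omega_\mu$ (resp. $\ker\omega_{\bar\mu}$) consists of the values of the fundamental vector fields of the isotropy algebra $\mathfrak g_\mu=\{\xi\in\mathfrak g:\langle\mu,[\xi,\eta]\rangle=0\ \forall\eta\in\mathfrak g\}$ (resp. of the isotropy algebra $(\mathfrak g_{\bar M})_{\bar\mu}$,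 defined in the same way). There are symplectic forms $\hat\Omega$ on $J^{-1}(\mu)/\ker\Omega_\mu$ and $\hat\omega$ on $\bar J^{-1}(\bar\mu)/\ker\omega_{\bar\mu}$ and smooth functions $\hat H$, $\hat h$ on these quotients with $\pi_\mu^*\hat\Omega=\Omega_\mu$, $\pi_\mu^*\hat H=H_\mu$, $\pi_{\bar\mu}^*\hat\omega=\omega_{\bar\mu}$, $\pi_{\bar\mu}^*\hat h=H_{\bar\mu}$, and there is a diffeomorphism $$\rho:\ J^{-1}(\mu)/\ker\Omega_\mu\longrightarrow\bar J^{-1}(\bar\mu)/\ker\omega_{\bar\mu}$$ such that $\rho(\pi_\mu(p))=\pi_{\bar\mu}(\pi_M(p))$ for all $p\in J^{-1}(\mu)$, $\hat\Omega=\rho^*\hat\omega$ and $\hat H=\rho^*\hat h$. -/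

import Mathlib

open scoped Manifold ContDiff

noncomputable section

namespace Presymplectic

/-! ### Differential 2-forms -/

/-- A (not necessarily smooth) field of alternating bilinear forms on the tangent spaces of `M`. -/
abbrev TwoForm (E : Type*) [NormedAddCommGroup E] [NormedSpace ℝ E]
    (M : Type*) [TopologicalSpace M] [ChartedSpace E M] : Type _ :=
  ∀ x : M, TangentSpace 𝓘(ℝ, E) x [⋀^Fin 2]→L[ℝ] ℝ

section Forms

variable {E : Type*} [NormedAddCommGroup E] [NormedSpace ℝ E]
  {M : Type*} [TopologicalSpace M] [ChartedSpace E M]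
  {E' : Type*} [NormedAddCommGroup E'] [NormedSpace ℝ E']
  {M' : Type*} [TopologicalSpace M'] [ChartedSpace E' M']

/-- The expression of a 2-form in the preferred chart at `x₀`, as a form on the model space. -/
def TwoForm.inChart (Ω : TwoForm E M) (x₀ : M) (y : E) : E [⋀^Fin 2]→L[ℝ] ℝ :=
  (Ω ((extChartAt 𝓘(ℝ, E) x₀).symm y)).compContinuousLinearMap
    (mfderiv 𝓘(ℝ, E) 𝓘(ℝ, E) (extChartAt 𝓘(ℝ, E) x₀).symm y)

/-- The 2-form is `C^∞`. -/
def TwoForm.IsSmooth (Ω : TwoForm E M) : Prop :=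
  ∀ x₀ : M, ContDiffOn ℝ ∞ (Ω.inChart x₀) (extChartAt 𝓘(ℝ, E) x₀).target

/-- `dΩ = 0`. -/
def TwoForm.IsClosed (Ω : TwoForm E M) : Prop :=
  ∀ x₀ : M, ∀ y ∈ (extChartAt 𝓘(ℝ, E) x₀).target, extDeriv (Ω.inChart x₀) y = 0

/-- The pull-back `f^*Ω`. -/
def TwoForm.pullback (f : M → M') (Ω : TwoForm E' M') : TwoForm E M := fun x =>
  (Ω (f x)).compContinuousLinearMap (mfderiv 𝓘(ℝ, E) 𝓘(ℝ, E') f x)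

/-- The kernel `ker Ω_x = {v ∈ T_x M | i(v) Ω_x = 0}`. -/
def TwoForm.kerAt (Ω : TwoForm E M) (x : M) : Submodule ℝ (TangentSpace 𝓘(ℝ, E) x) where
  carrier := {v | ∀ w : TangentSpace 𝓘(ℝ, E) x, Ω x ![v, w] = 0}
  zero_mem' := fun w => (Ω x).map_coord_zero 0 rfl
  add_mem' := by
    intro a b ha hb w
    have h := (Ω x).toMultilinearMap.cons_add ![w] a b
    change Ω x ![a + b, w] = Ω x ![a, w] + Ω x ![b, w] at h
    rw [h, ha w, hb w, add_zero]
  smul_mem' := by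
    intro c a ha w
    have h := (Ω x).toMultilinearMap.cons_smul ![w] c a
    change Ω x ![c • a, w] = c • Ω x ![a, w] at h
    rw [h, ha w, smul_zero]

/-- A presymplectic form: a smooth closed 2-form of constant rank. -/
structure IsPresymplectic (Ω : TwoForm E M) : Prop where
  smooth : Ω.IsSmooth
  closed : Ω.IsClosed
  constant_rank : ∃ r : ℕ, ∀ x : M, Module.finrank ℝ (Ω.kerAt x) = r

/-- A symplectic form: a smooth closed nondegenerate 2-form. -/
structure IsSymplectic (Ω : TwoForm E M) : Prop where
  smooth : Ω.IsSmooth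
  closed : Ω.IsClosed
  nondegenerate : ∀ x : M, Ω.kerAt x = ⊥

/-- A smooth vector field on `M`. -/
def IsSmoothVectorField [IsManifold 𝓘(ℝ, E) ∞ M] (X : ∀ x : M, TangentSpace 𝓘(ℝ, E) x) : Prop :=
  ContMDiff 𝓘(ℝ, E) 𝓘(ℝ, E).tangent ∞
    (fun x => (⟨x, X x⟩ : TangentBundle 𝓘(ℝ, E) M))

/-- The presymplectic Hamiltonian system `(M, Ω, H)` is compatible: the equation
`i(X) Ω = dH` has a smooth solution `X` on all of `M`. -/
def IsCompatible [IsManifold 𝓘(ℝ, E) ∞ M] (Ω : TwoForm E M) (H : M → ℝ) : Prop :=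
  ∃ X : ∀ x : M, TangentSpace 𝓘(ℝ, E) x, IsSmoothVectorField X ∧
    ∀ (x : M) (v : TangentSpace 𝓘(ℝ, E) x), Ω x ![X x, v] = mfderiv 𝓘(ℝ, E) 𝓘(ℝ, ℝ) H x v

/-! ### The quotient by the foliation `ker Ω` -/

/-- `p` and `q` are joined by a smooth curve that is everywhere tangent to `ker Ω`. -/
def KerJoined (Ω : TwoForm E M) (p q : M) : Prop :=
  ∃ γ : ℝ → M, ContMDiff 𝓘(ℝ, ℝ) 𝓘(ℝ, E) ∞ γ ∧ γ 0 = p ∧ γ 1 = q ∧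
    ∀ t : ℝ, mfderiv 𝓘(ℝ, ℝ) 𝓘(ℝ, E) γ t (1 : ℝ) ∈ Ω.kerAt (γ t)

/-- Two points are equivalent if they lie in the same leaf of the foliation `ker Ω`, that is, if
they are joined by a piecewise smooth curve tangent to `ker Ω`. -/
def leafSetoid (Ω : TwoForm E M) : Setoid M := Relation.EqvGen.setoid (KerJoined Ω)

/-- The space `M / ker Ω` of leaves, with the quotient topology. -/
abbrev LeafSpace (Ω : TwoForm E M) : Type _ := Quotient (leafSetoid Ω)

/-- The canonical projection `M → M / ker Ω`. -/
def leafProj (Ω : TwoForm E M) (x : M) : LeafSpace Ω := Quotient.mk (leafSetoid Ω) x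

/-- The given smooth structure on `M / ker Ω` is the quotient one: the canonical projection is a
submersion, and the tangent space of the leaf through `x` is `ker Ω_x`. -/
structure IsLeafQuotient (Ω : TwoForm E M) [ChartedSpace E' (LeafSpace Ω)] : Prop where
  submersion : Manifold.IsSubmersion 𝓘(ℝ, E) 𝓘(ℝ, E') ∞ (leafProj Ω)
  ker_mfderiv : ∀ (x : M) (v : TangentSpace 𝓘(ℝ, E) x),
    mfderiv 𝓘(ℝ, E) 𝓘(ℝ, E') (leafProj Ω) x v = 0 ↔ v ∈ Ω.kerAt x

/-- `(M', Ω', H')` is the symplectic Hamiltonian system induced by `(M, Ω, H)` on the quotient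
`π : M → M'`: one has `π^*Ω' = Ω` and `π^*H' = H`. -/
structure IsReducedSystem (π : M → M') (Ω : TwoForm E M) (H : M → ℝ)
    (Ω' : TwoForm E' M') (H' : M' → ℝ) : Prop where
  symplectic : IsSymplectic Ω'
  pullback_form : TwoForm.pullback π Ω' = Ω
  smooth : ContMDiff 𝓘(ℝ, E') 𝓘(ℝ, ℝ) ∞ H'
  pullback_ham : H' ∘ π = H

end Forms

/-! ### Lie group actions and momentum mappings -/

section Actions

variable {F : Type*} [NormedAddCommGroup F] [NormedSpace ℝ F]
  (G : Type*) [TopologicalSpace G] [ChartedSpace F G] [Group G]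
  {E : Type*} [NormedAddCommGroup E] [NormedSpace ℝ E]
  {M : Type*} [TopologicalSpace M] [ChartedSpace E M] [MulAction G M]

variable {G} in
/-- The fundamental vector field of `ξ`, the derivative at `1` of `g ↦ g • x` along `ξ`. -/
def fundamentalField (ξ : GroupLieAlgebra 𝓘(ℝ, F) G) (x : M) : TangentSpace 𝓘(ℝ, E) x :=
  mfderiv 𝓘(ℝ, F) 𝓘(ℝ, E) (fun g : G => g • x) 1 ξ

/-- `G` acts by symmetries of `(M, Ω, H)`: it preserves the form and the Hamiltonian. -/
structure IsSymmetryGroup (Ω : TwoForm E M) (H : M → ℝ) : Prop where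
  presymplectic : ∀ g : G, TwoForm.pullback (fun x : M => g • x) Ω = Ω
  invariant : ∀ (g : G) (x : M), H (g • x) = H x

/-- `J : M → 𝔤^*` is a momentum mapping of a Poissonian action: with `f_ξ = ⟨J, ξ⟩` one has
`i(ξ_M) Ω = d f_ξ`, and `ξ ↦ f_ξ` is a homomorphism of Lie algebras, where the Poisson bracket is
`{f_ξ, f_η} = Ω(ξ_M, η_M)`. -/
structure IsPoissonianMomentumMap (Ω : TwoForm E M)
    (J : M → Module.Dual ℝ (GroupLieAlgebra 𝓘(ℝ, F) G)) : Prop where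
  smooth : ∀ ξ, ContMDiff 𝓘(ℝ, E) 𝓘(ℝ, ℝ) ∞ (fun x => J x ξ)
  hamiltonian : ∀ (ξ : GroupLieAlgebra 𝓘(ℝ, F) G) (x : M) (v : TangentSpace 𝓘(ℝ, E) x),
    Ω x ![fundamentalField ξ x, v] = mfderiv 𝓘(ℝ, E) 𝓘(ℝ, ℝ) (fun y => J y ξ) x v
  poisson : ∀ (ξ η : GroupLieAlgebra 𝓘(ℝ, F) G) (x : M),
    J x ⁅ξ, η⁆ = Ω x ![fundamentalField ξ x, fundamentalField η x]

variable {G} in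
/-- The level set `J⁻¹(μ)`. -/
abbrev LevelSet (J : M → Module.Dual ℝ (GroupLieAlgebra 𝓘(ℝ, F) G))
    (μ : Module.Dual ℝ (GroupLieAlgebra 𝓘(ℝ, F) G)) : Type _ := {x : M // J x = μ}

variable {G} in
/-- `μ` is a weakly regular value of `J`: with the given smooth structure `J⁻¹(μ)` is an embedded
submanifold of `M`, and its tangent space at each point `x` is `ker T_x J`. -/
structure IsWeaklyRegularValue (J : M → Module.Dual ℝ (GroupLieAlgebra 𝓘(ℝ, F) G))
    (μ : Module.Dual ℝ (GroupLieAlgebra 𝓘(ℝ, F) G))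
    {E' : Type*} [NormedAddCommGroup E'] [NormedSpace ℝ E']
    [ChartedSpace E' (LevelSet J μ)] : Prop where
  embedding : Manifold.IsSmoothEmbedding 𝓘(ℝ, E') 𝓘(ℝ, E) ∞ (Subtype.val : LevelSet J μ → M)
  tangent : ∀ (x : LevelSet J μ) (v : TangentSpace 𝓘(ℝ, E) (x : M)),
    (∃ u : TangentSpace 𝓘(ℝ, E') x,
      mfderiv 𝓘(ℝ, E') 𝓘(ℝ, E) (Subtype.val : LevelSet J μ → M) x u = v) ↔
    ∀ ξ, mfderiv 𝓘(ℝ, E) 𝓘(ℝ, ℝ) (fun y => J y ξ) (x : M) v = 0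

variable {G} in
/-- The form `Ω_μ` induced by `Ω` on `J⁻¹(μ)`. -/
def levelForm (E' : Type*) [NormedAddCommGroup E'] [NormedSpace ℝ E'] (Ω : TwoForm E M)
    (J : M → Module.Dual ℝ (GroupLieAlgebra 𝓘(ℝ, F) G))
    (μ : Module.Dual ℝ (GroupLieAlgebra 𝓘(ℝ, F) G)) [ChartedSpace E' (LevelSet J μ)] :
    TwoForm E' (LevelSet J μ) :=
  TwoForm.pullback (Subtype.val : LevelSet J μ → M) Ω

variable {G} in
/-- At each point of `J⁻¹(μ)` the kernel of the induced form consists of the values of the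
fundamental vector fields of the isotropy algebra `𝔤_μ = {ξ | ⟨μ, [ξ, η]⟩ = 0 for all η}`. -/
def KerIsIsotropyDirections (E' : Type*) [NormedAddCommGroup E'] [NormedSpace ℝ E']
    (Ω : TwoForm E M) (J : M → Module.Dual ℝ (GroupLieAlgebra 𝓘(ℝ, F) G))
    (μ : Module.Dual ℝ (GroupLieAlgebra 𝓘(ℝ, F) G)) [ChartedSpace E' (LevelSet J μ)] : Prop :=
  ∀ (x : LevelSet J μ) (v : TangentSpace 𝓘(ℝ, E) (x : M)),
    (∃ u ∈ (levelForm E' Ω J μ).kerAt x,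
      mfderiv 𝓘(ℝ, E') 𝓘(ℝ, E) (Subtype.val : LevelSet J μ → M) x u = v) ↔
    ∃ ξ : GroupLieAlgebra 𝓘(ℝ, F) G, (∀ η : GroupLieAlgebra 𝓘(ℝ, F) G, μ ⁅ξ, η⁆ = 0) ∧ fundamentalField ξ (x : M) = v

variable {G} in
/-- `ker Ω ⊆ C^∞(M) ⊗ {fundamental vector fields of elements of 𝔥}`, for vector fields. -/
def KerGeneratedBy [IsManifold 𝓘(ℝ, E) ∞ M] (𝔥 : Submodule ℝ (GroupLieAlgebra 𝓘(ℝ, F) G)) (Ω : TwoForm E M) : Prop :=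
  ∀ Z : ∀ x : M, TangentSpace 𝓘(ℝ, E) x, IsSmoothVectorField Z → (∀ x, Z x ∈ Ω.kerAt x) →
    ∃ (n : ℕ) (f : Fin n → M → ℝ) (ξ : Fin n → GroupLieAlgebra 𝓘(ℝ, F) G),
      (∀ i, ContMDiff 𝓘(ℝ, E) 𝓘(ℝ, ℝ) ∞ (f i)) ∧ (∀ i, ξ i ∈ 𝔥) ∧
      ∀ x, Z x = ∑ i, f i x • (fundamentalField (ξ i) x : TangentSpace 𝓘(ℝ, E) x)

variable {G} in
/-- `𝔥` is the Lie algebra of the closed subgroup `K`: it consists of the initial velocities of the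
smooth one-parameter subgroups of `G` contained in `K`. -/
def IsLieAlgebraOf (𝔥 : Submodule ℝ (GroupLieAlgebra 𝓘(ℝ, F) G)) (K : Subgroup G) : Prop :=
  ∀ ξ : GroupLieAlgebra 𝓘(ℝ, F) G, ξ ∈ 𝔥 ↔
    ∃ γ : ℝ → G, ContMDiff 𝓘(ℝ, ℝ) 𝓘(ℝ, F) ∞ γ ∧ γ 0 = 1 ∧ (∀ s t, γ (s + t) = γ s * γ t) ∧
      (∀ t, γ t ∈ K) ∧ mfderiv 𝓘(ℝ, ℝ) 𝓘(ℝ, F) γ 0 (1 : ℝ) = ξ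

variable {G} in
/-- The projection `𝔤 → 𝔤 / 𝔥` of Lie algebras, the derivative at `1` of `G → G ⧸ K`. -/
def lieProj (K : Subgroup G) [K.Normal] (F' : Type*) [NormedAddCommGroup F'] [NormedSpace ℝ F']
    [ChartedSpace F' (G ⧸ K)] :
    GroupLieAlgebra 𝓘(ℝ, F) G →ₗ[ℝ] GroupLieAlgebra 𝓘(ℝ, F') (G ⧸ K) :=
  (mfderiv 𝓘(ℝ, F) 𝓘(ℝ, F') (fun g : G => (g : G ⧸ K)) 1).toLinearMap

end Actions

end Presymplectic

end

open Presymplectic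

/-! By `IsWeaklyRegularValue`, the tangent space of `J⁻¹(μ)` at `x` is `ker T_x J`, which is the
`Ω`-orthogonal of the orbit directions `T_x(G·x)`. Hence `ker Ω_μ` consists of the vectors that lie
both in this orthogonal and in the double orthogonal. The double orthogonal is `T_x(G·x) + ker Ω`,
and `ker Ω` lies in `T_x(G·x)` because it is generated by fundamental fields. So a kernel vector is
a fundamental vector orthogonal to all others, and `J[ξ, η] = Ω(ξ_M, η_M)` turns orthogonality into
the isotropy condition (`kerIsIsotropyDirections_of_momentumMap`). The same argument works on `M/ker
Ω`, where the kernel is zero, once `J₁` is known to be a momentum map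
(`IsPoissonianMomentumMap.descend`).

Since `J` is `J₁ ∘ π` up to the surjection `lieProj`, the set `J⁻¹(μ)` is the full preimage of
`J₁⁻¹(μ₁)`. The restriction `τ` of `π` is therefore onto, has smooth local sections, and pulls the
lower induced form back to `Ω_μ`. Its fibres are whole leaves of `ker Ω`, each contained in a leaf
of `ker Ω_μ`. These facts make the two leaf spaces diffeomorphic
(`IsLeafQuotient.exists_diffeomorph`).

A closed form descends to the leaf space of its kernel (`exists_form_on_leafSpace`): locally
Cartan's formula removes the dependence on the fibre, and the local forms agree along a leaf because
leaves are connected by curves. The Hamiltonian descends because it is invariant and the kernel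
directions are fundamental. Form and Hamiltonian are built on the lower quotient and transported by
`ρ`. -/

noncomputable section

open scoped Topology
open Set Filter

namespace Presymplectic

/-! ### Smooth dependence of pulled back alternating forms on the form and the linear map. -/

section Alternating

variable {E : Type*} [NormedAddCommGroup E] [NormedSpace ℝ E]
  {E' : Type*} [NormedAddCommGroup E'] [NormedSpace ℝ E']

/-- Alternatization as a continuous linear map. -/
def alternatizationL (ι : Type*) [Fintype ι] [DecidableEq ι] :
    ContinuousMultilinearMap ℝ (fun _ : ι => E) ℝ →L[ℝ] E [⋀^ι]→L[ℝ] ℝ :=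
  LinearMap.mkContinuous
    { toFun := ContinuousMultilinearMap.alternatization
      map_add' := map_add _
      map_smul' := fun c f => by
        ext v
        simp [ContinuousMultilinearMap.alternatization_apply_apply, Finset.mul_sum,
          Units.smul_def, mul_left_comm] }
    (Fintype.card (Equiv.Perm ι))
    (fun f => by
      refine ContinuousAlternatingMap.opNorm_le_bound _ (by positivity) fun v => ?_
      simp only [LinearMap.coe_mk, AddHom.coe_mk,
        ContinuousMultilinearMap.alternatization_apply_apply]
      refine (norm_sum_le _ _).trans ?_
      rw [mul_assoc, ← nsmul_eq_mul]
      refine Finset.sum_le_card_nsmul _ _ _ fun σ _ => ?_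
      rw [Units.smul_def, norm_smul]
      have h1 : ‖((Equiv.Perm.sign σ : ℤˣ) : ℤ)‖ = 1 := by
        rcases Int.units_eq_one_or (Equiv.Perm.sign σ) with h | h <;> simp [h]
      rw [h1, one_mul]
      refine (f.le_opNorm _).trans_eq ?_
      congr 1
      exact Equiv.prod_comp σ fun i => ‖v i‖)

/-- The factor is `2!`, the number of permutations summed over. -/
theorem alternatizationL_toContinuousMultilinearMap (α : E [⋀^Fin 2]→L[ℝ] ℝ) :
    alternatizationL (Fin 2) α.toContinuousMultilinearMap = (2 : ℝ) • α := by
  ext v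
  have : MultilinearMap.alternatization (α.toAlternatingMap : MultilinearMap ℝ (fun _ => E) ℝ) v
    = (Nat.factorial (Fintype.card (Fin 2)) • α.toAlternatingMap) v := by
    rw [AlternatingMap.coe_alternatization]
  simp at this
  simp only [alternatizationL, LinearMap.mkContinuous_apply, LinearMap.coe_mk, AddHom.coe_mk,
     ContinuousMultilinearMap.alternatization_apply_apply]
  simp [MultilinearMap.alternatization_apply] at this ⊢
  exact this

/-- As a multilinear map, the pull-back is linear in the form and multilinear in the copies of `f`,
hence smooth. Half the alternatization, a bounded linear operator, returns to alternating forms. -/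
theorem ContDiffAt.compContinuousLinearMap_two {X : Type*} [NormedAddCommGroup X] [NormedSpace ℝ X]
    {n : WithTop ℕ∞}
    {α : X → E' [⋀^Fin 2]→L[ℝ] ℝ} {f : X → E →L[ℝ] E'} {x : X}
    (hα : ContDiffAt ℝ n α x) (hf : ContDiffAt ℝ n f x) :
    ContDiffAt ℝ n (fun z => (α z).compContinuousLinearMap (f z)) x := by
  have h : (fun z => (α z).compContinuousLinearMap (f z)) = fun z => (2 : ℝ)⁻¹ •
      alternatizationL (Fin 2)
        ((ContinuousMultilinearMap.compContinuousLinearMapContinuousMultilinear ℝ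
        (fun _ : Fin 2 ↦ E) (fun _ ↦ E') ℝ (fun _ => f z)) (α z).toContinuousMultilinearMap) := by
    funext z
    have := alternatizationL_toContinuousMultilinearMap ((α z).compContinuousLinearMap (f z))
    rw [eq_inv_smul_iff₀ two_ne_zero, ← this]
    rfl
  rw [h]
  have hin : ContDiffAt ℝ n (fun z =>
      (ContinuousMultilinearMap.compContinuousLinearMapContinuousMultilinear ℝ
        (fun _ : Fin 2 ↦ E) (fun _ ↦ E') ℝ (fun _ => f z)) (α z).toContinuousMultilinearMap) x :=
    ContDiffAt.clm_apply
      ((ContinuousMultilinearMap.contDiff _).contDiffAt.comp x (contDiffAt_pi.2 fun _ => hf))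
      ((ContinuousAlternatingMap.toContinuousMultilinearMapCLM
        ℝ : (E' [⋀^Fin 2]→L[ℝ] ℝ) →L[ℝ] _).contDiff.contDiffAt.comp x hα)
  exact ((alternatizationL (E := E) (Fin 2)).contDiff.contDiffAt.comp x hin).const_smul _

end Alternating


/-! ### Derivatives and 2-forms with every tangent space read as the model space. -/

section Derivative

variable {E : Type*} [NormedAddCommGroup E] [NormedSpace ℝ E]
  {M : Type*} [TopologicalSpace M] [ChartedSpace E M]
  {E' : Type*} [NormedAddCommGroup E'] [NormedSpace ℝ E']
  {M' : Type*} [TopologicalSpace M'] [ChartedSpace E' M']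
  {E'' : Type*} [NormedAddCommGroup E''] [NormedSpace ℝ E'']
  {M'' : Type*} [TopologicalSpace M''] [ChartedSpace E'' M'']

/-- The derivative of a map of manifolds, as a map of the model spaces. -/
def mder (f : M → M') (x : M) : E →L[ℝ] E' := mfderiv 𝓘(ℝ, E) 𝓘(ℝ, E') f x

/-- The value of a 2-form, as a form on the model space. -/
def TwoForm.val (Ω : TwoForm E M) (x : M) : E [⋀^Fin 2]→L[ℝ] ℝ := Ω x

theorem mder_comp {g : M' → M''} {f : M → M'} {x : M}
    (hg : MDifferentiableAt 𝓘(ℝ, E') 𝓘(ℝ, E'') g (f x))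
    (hf : MDifferentiableAt 𝓘(ℝ, E) 𝓘(ℝ, E') f x) :
    mder (E := E) (E' := E'') (g ∘ f) x =
      (mder (E := E') (E' := E'') g (f x)).comp (mder (E := E) (E' := E') f x) :=
  mfderiv_comp x hg hf

theorem mder_congr {f g : M → M'} {x : M} (h : f =ᶠ[𝓝 x] g) :
    mder (E := E) (E' := E') f x = mder (E := E) (E' := E') g x :=
  h.mfderiv_eq

theorem mder_id (x : M) : mder (E := E) (E' := E) (id : M → M) x = ContinuousLinearMap.id ℝ E :=
  mfderiv_id

theorem mder_const (c : M') (x : M) : mder (E := E) (E' := E') (fun _ : M => c) x = 0 :=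
  mfderiv_const

theorem mder_eq_fderiv (f : E → E') (x : E) : mder (E := E) (E' := E') f x = fderiv ℝ f x :=
  mfderiv_eq_fderiv

theorem TwoForm.val_pullback (f : M → M') (Ω : TwoForm E' M') (x : M) :
    (TwoForm.pullback (E := E) f Ω).val x =
      (Ω.val (f x)).compContinuousLinearMap (mder (E := E) (E' := E') f x) :=
  rfl

theorem TwoForm.ext_val {Ω Ω' : TwoForm E M} (h : ∀ x, Ω.val x = Ω'.val x) : Ω = Ω' := funext h

theorem TwoForm.inChart_eq (Ω : TwoForm E M) (x₀ : M) (y : E) :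
    Ω.inChart x₀ y = (Ω.val ((extChartAt 𝓘(ℝ, E) x₀).symm y)).compContinuousLinearMap
      (mder (E := E) (E' := E) (extChartAt 𝓘(ℝ, E) x₀).symm y) := rfl

theorem TwoForm.mem_kerAt_iff (Ω : TwoForm E M) (x : M) (v : E) :
    v ∈ Ω.kerAt x ↔ ∀ w : E, Ω.val x ![v, w] = 0 := Iff.rfl

theorem compContinuousLinearMap_apply_two (α : E' [⋀^Fin 2]→L[ℝ] ℝ) (f : E →L[ℝ] E') (v w : E) :
    α.compContinuousLinearMap f ![v, w] = α ![f v, f w] := by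
  rw [ContinuousAlternatingMap.compContinuousLinearMap_apply]
  congr 1
  ext i
  fin_cases i <;> rfl

theorem compContinuousLinearMap_comp (α : E'' [⋀^Fin 2]→L[ℝ] ℝ) (g : E' →L[ℝ] E'') (f : E →L[ℝ] E') :
    α.compContinuousLinearMap (g.comp f) =
      (α.compContinuousLinearMap g).compContinuousLinearMap f := rfl

/-- Arguments lift through `f`. This gives uniqueness of a form on the base of a submersion. -/
theorem compContinuousLinearMap_injective {f : E →L[ℝ] E'} (hf : Function.Surjective f)
    {α β : E' [⋀^Fin 2]→L[ℝ] ℝ} (h : α.compContinuousLinearMap f = β.compContinuousLinearMap f) :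
    α = β := by
  ext v
  choose g hg using hf
  have := congrArg (fun a => a (g ∘ v)) h
  simp only [ContinuousAlternatingMap.compContinuousLinearMap_apply] at this
  have hv : (f ∘ g ∘ v) = v := funext fun i => hg _
  rwa [hv] at this

theorem TwoForm.pullback_comp {g : M' → M''} {f : M → M'} (Ω : TwoForm E'' M'')
    (hg : MDifferentiable 𝓘(ℝ, E') 𝓘(ℝ, E'') g)
    (hf : MDifferentiable 𝓘(ℝ, E) 𝓘(ℝ, E') f) :
    TwoForm.pullback (E := E) (g ∘ f) Ω
      = TwoForm.pullback (E := E) f (TwoForm.pullback (E := E') g Ω) := by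
  refine TwoForm.ext_val fun x => ?_
  rw [TwoForm.val_pullback, mder_comp (hg (f x)) (hf x)]
  rfl

theorem TwoForm.pullback_id (Ω : TwoForm E M) : TwoForm.pullback (E := E) id Ω = Ω := by
  refine TwoForm.ext_val fun x => ?_
  rw [TwoForm.val_pullback, mder_id]
  ext v
  rfl

end Derivative

/-! ### Smoothness and closedness as pointwise, chart-independent conditions. -/

section SmoothClosed

variable {E : Type*} [NormedAddCommGroup E] [NormedSpace ℝ E]
  {M : Type*} [TopologicalSpace M] [ChartedSpace E M]
  {E' : Type*} [NormedAddCommGroup E'] [NormedSpace ℝ E']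
  {M' : Type*} [TopologicalSpace M'] [ChartedSpace E' M']

/-- Near a point, a pulled back form in a chart is the pull-back of the form in a chart. -/
theorem TwoForm.inChart_pullback_eventuallyEq [IsManifold 𝓘(ℝ, E) ∞ M] [IsManifold 𝓘(ℝ, E') ∞ M']
    (Ω : TwoForm E' M') {f : M → M'} {x₀ p : M} (hp : p ∈ (extChartAt 𝓘(ℝ, E) x₀).source)
    (hf : ContMDiffAt 𝓘(ℝ, E) 𝓘(ℝ, E') ∞ f p) :
    let F : E → E' := extChartAt 𝓘(ℝ, E') (f p) ∘ f ∘ (extChartAt 𝓘(ℝ, E) x₀).symm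
    (TwoForm.pullback (E := E) f Ω).inChart x₀ =ᶠ[𝓝 (extChartAt 𝓘(ℝ, E) x₀ p)]
      fun z => (Ω.inChart (f p) (F z)).compContinuousLinearMap (fderiv ℝ F z) := by
  intro F
  set φ := extChartAt 𝓘(ℝ, E) x₀
  set ψ := extChartAt 𝓘(ℝ, E') (f p)
  have hφp : φ.symm (φ p) = p := φ.left_inv hp
  have hz : φ p ∈ φ.target := φ.map_source hp
  have hcont : ContinuousAt φ.symm (φ p) := continuousAt_extChartAt_symm'' hz
  have e1 : ∀ᶠ z in 𝓝 (φ p), z ∈ φ.target := (isOpen_extChartAt_target x₀).mem_nhds hz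
  have e2 : ∀ᶠ z in 𝓝 (φ p), MDifferentiableAt 𝓘(ℝ, E) 𝓘(ℝ, E') f (φ.symm z) := by
    have h1 : ContMDiffAt 𝓘(ℝ, E) 𝓘(ℝ, E') 1 f p := hf.of_le (by simp)
    have h2 := (contMDiffAt_iff_contMDiffAt_nhds (by simp)).1 h1
    rw [← hφp] at h2
    exact (hcont.eventually h2).mono fun z hz => hz.mdifferentiableAt (by simp)
  have e3 : ∀ᶠ z in 𝓝 (φ p), f (φ.symm z) ∈ ψ.source := by
    have h1 : ContinuousAt (f ∘ φ.symm) (φ p) := by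
      apply ContinuousAt.comp _ hcont
      rw [hφp]; exact hf.continuousAt
    apply h1
    rw [Function.comp_apply, hφp]
    exact extChartAt_source_mem_nhds (f p)
  filter_upwards [e1, e2, e3, e3.eventually_nhds] with z h1 h2 h3 h4
  have hφs : MDifferentiableAt 𝓘(ℝ, E) 𝓘(ℝ, E) φ.symm z :=
    ((contMDiffOn_extChartAt_symm (n := ∞) x₀).contMDiffAt
      ((isOpen_extChartAt_target x₀).mem_nhds h1)).mdifferentiableAt (by simp)
  have hψ : MDifferentiableAt 𝓘(ℝ, E') 𝓘(ℝ, E') ψ (f (φ.symm z)) :=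
    ((contMDiffOn_extChartAt (n := ∞) (x := f p)).contMDiffAt
      ((chartAt E' (f p)).open_source.mem_nhds (by simpa [ψ] using h3))).mdifferentiableAt (by simp)
  have hψs : MDifferentiableAt 𝓘(ℝ, E') 𝓘(ℝ, E') ψ.symm (F z) :=
    ((contMDiffOn_extChartAt_symm (n := ∞) (f p)).contMDiffAt
      ((isOpen_extChartAt_target (f p)).mem_nhds (ψ.map_source h3))).mdifferentiableAt (by simp)
  have hF : MDifferentiableAt 𝓘(ℝ, E) 𝓘(ℝ, E') F z := hψ.comp z (h2.comp z hφs)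
  -- Chain rule applied to both sides of `ψ⁻¹ ∘ F = f ∘ φ⁻¹`.
  have key : (mder (E := E') (E' := E') ψ.symm (F z)).comp (fderiv ℝ F z) =
      (mder (E := E) (E' := E') f (φ.symm z)).comp (mder (E := E) (E' := E) φ.symm z) := by
    rw [← mder_eq_fderiv, ← mder_comp hψs hF, ← mder_comp h2 hφs]
    apply mder_congr
    filter_upwards [h4] with w hw
    exact ψ.left_inv hw
  rw [TwoForm.inChart_eq, TwoForm.inChart_eq, TwoForm.val_pullback,
    ← compContinuousLinearMap_comp, ← compContinuousLinearMap_comp]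
  change _ = (Ω.val (ψ.symm (F z))).compContinuousLinearMap _
  rw [← key]
  have : ψ.symm (F z) = f (φ.symm z) := ψ.left_inv h3
  rw [this]

/-- The form is smooth and closed at the point `p`. -/
def TwoForm.SmoothClosedAt (Ω : TwoForm E M) (p : M) : Prop :=
  ContDiffAt ℝ ∞ (Ω.inChart p) (extChartAt 𝓘(ℝ, E) p p) ∧
    extDeriv (Ω.inChart p) (extChartAt 𝓘(ℝ, E) p p) = 0

/-- The exterior derivative commutes with pull-back along the chart expression of `f`. The chart at
`x₀` need not be centred at `p`, so `f = id` yields independence of the chart. -/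
theorem TwoForm.SmoothClosedAt.inChart_pullback [IsManifold 𝓘(ℝ, E) ∞ M] [IsManifold 𝓘(ℝ, E') ∞ M']
    {Ω : TwoForm E' M'} {f : M → M'} {x₀ p : M} (hΩ : Ω.SmoothClosedAt (f p))
    (hp : p ∈ (extChartAt 𝓘(ℝ, E) x₀).source) (hf : ContMDiffAt 𝓘(ℝ, E) 𝓘(ℝ, E') ∞ f p) :
    ContDiffAt ℝ ∞ ((TwoForm.pullback (E := E) f Ω).inChart x₀) (extChartAt 𝓘(ℝ, E) x₀ p) ∧
    extDeriv ((TwoForm.pullback (E := E) f Ω).inChart x₀) (extChartAt 𝓘(ℝ, E) x₀ p) = 0 := by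
  have h := TwoForm.inChart_pullback_eventuallyEq Ω hp hf
  set F : E → E' := extChartAt 𝓘(ℝ, E') (f p) ∘ f ∘ (extChartAt 𝓘(ℝ, E) x₀).symm with hFdef
  have hφp : (extChartAt 𝓘(ℝ, E) x₀).symm (extChartAt 𝓘(ℝ, E) x₀ p) = p :=
    (extChartAt 𝓘(ℝ, E) x₀).left_inv hp
  have hFp : F (extChartAt 𝓘(ℝ, E) x₀ p) = extChartAt 𝓘(ℝ, E') (f p) (f p) := by
    simp only [hFdef, Function.comp_apply, hφp]
  have hF : ContDiffAt ℝ ∞ F (extChartAt 𝓘(ℝ, E) x₀ p) := by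
    rw [← contMDiffAt_iff_contDiffAt]
    have h1 : ContMDiffAt 𝓘(ℝ, E) 𝓘(ℝ, E) ∞ (extChartAt 𝓘(ℝ, E) x₀).symm
        (extChartAt 𝓘(ℝ, E) x₀ p) :=
      (contMDiffOn_extChartAt_symm (n := ∞) x₀).contMDiffAt
        ((isOpen_extChartAt_target x₀).mem_nhds ((extChartAt 𝓘(ℝ, E) x₀).map_source hp))
    refine ContMDiffAt.comp (I' := 𝓘(ℝ, E')) (M' := M') _ ?_ (ContMDiffAt.comp _ ?_ h1)
    · rw [Function.comp_apply, hφp]; exact contMDiffAt_extChartAt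
    · rwa [hφp]
  have hd : ContDiffAt ℝ ∞ (Ω.inChart (f p)) (F (extChartAt 𝓘(ℝ, E) x₀ p)) := by
    rw [hFp]; exact hΩ.1
  refine ⟨?_, ?_⟩
  · refine ContDiffAt.congr_of_eventuallyEq ?_ h
    have h1 := hd.comp _ hF
    have h2 : ContDiffAt ℝ ∞ (fderiv ℝ F) (extChartAt 𝓘(ℝ, E) x₀ p) :=
      hF.fderiv_right (by simp)
    exact h1.compContinuousLinearMap_two h2
  · rw [h.extDeriv_eq, extDeriv_pullback (r := ∞) (hd.differentiableAt (by simp)) hF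
      (by simp [minSmoothness_of_isRCLikeNormedField]; exact WithTop.coe_le_coe.2 (le_top : (2 : ℕ∞) ≤ ⊤)), hFp,
      hΩ.2]
    ext v
    rfl

theorem TwoForm.SmoothClosedAt.pullback [IsManifold 𝓘(ℝ, E) ∞ M] [IsManifold 𝓘(ℝ, E') ∞ M']
    {Ω : TwoForm E' M'} {f : M → M'} {p : M} (hΩ : Ω.SmoothClosedAt (f p))
    (hf : ContMDiffAt 𝓘(ℝ, E) 𝓘(ℝ, E') ∞ f p) :
    (TwoForm.pullback (E := E) f Ω).SmoothClosedAt p :=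
  hΩ.inChart_pullback (mem_extChartAt_source p) hf

theorem TwoForm.SmoothClosedAt.congr {Ω Ω' : TwoForm E M} {p : M} (h : Ω.SmoothClosedAt p)
    (h' : ∀ᶠ x in 𝓝 p, Ω'.val x = Ω.val x) : Ω'.SmoothClosedAt p := by
  have : Ω'.inChart p =ᶠ[𝓝 (extChartAt 𝓘(ℝ, E) p p)] Ω.inChart p := by
    have hc : ContinuousAt (extChartAt 𝓘(ℝ, E) p).symm (extChartAt 𝓘(ℝ, E) p p) :=
      continuousAt_extChartAt_symm p
    have h1 := hc.eventually (p := fun x => Ω'.val x = Ω.val x)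
      (by rwa [extChartAt_to_inv])
    filter_upwards [h1] with z hz
    rw [TwoForm.inChart_eq, TwoForm.inChart_eq, hz]
  exact ⟨h.1.congr_of_eventuallyEq this, by rw [this.extDeriv_eq, h.2]⟩

theorem TwoForm.smoothClosedAt_of_isSmooth_of_isClosed {Ω : TwoForm E M} (hs : Ω.IsSmooth)
    (hc : Ω.IsClosed) (p : M) : Ω.SmoothClosedAt p :=
  ⟨(hs p).contDiffAt (extChartAt_target_mem_nhds p), hc p _ (mem_extChartAt_target p)⟩

theorem TwoForm.inChart_of_smoothClosedAt [IsManifold 𝓘(ℝ, E) ∞ M] {Ω : TwoForm E M}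
    (h : ∀ p, Ω.SmoothClosedAt p) (x₀ : M) {y : E} (hy : y ∈ (extChartAt 𝓘(ℝ, E) x₀).target) :
    ContDiffAt ℝ ∞ (Ω.inChart x₀) y ∧ extDeriv (Ω.inChart x₀) y = 0 := by
  have := (h ((extChartAt 𝓘(ℝ, E) x₀).symm y)).inChart_pullback (f := id)
    ((extChartAt 𝓘(ℝ, E) x₀).map_target hy) contMDiffAt_id
  rwa [TwoForm.pullback_id, (extChartAt 𝓘(ℝ, E) x₀).right_inv hy] at this

theorem TwoForm.isSmooth_of_smoothClosedAt [IsManifold 𝓘(ℝ, E) ∞ M] {Ω : TwoForm E M}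
    (h : ∀ p, Ω.SmoothClosedAt p) : Ω.IsSmooth := fun x₀ _ hy =>
  (inChart_of_smoothClosedAt h x₀ hy).1.contDiffWithinAt

theorem TwoForm.isClosed_of_smoothClosedAt [IsManifold 𝓘(ℝ, E) ∞ M] {Ω : TwoForm E M}
    (h : ∀ p, Ω.SmoothClosedAt p) : Ω.IsClosed := fun x₀ _ hy =>
  (inChart_of_smoothClosedAt h x₀ hy).2

/-- On a vector space, a smooth closed form is smooth and closed as a map to alternating forms. -/
theorem TwoForm.SmoothClosedAt.modelSpace {Ω : TwoForm E E} {p : E} (h : Ω.SmoothClosedAt p) :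
    ContDiffAt ℝ ∞ Ω.val p ∧ extDeriv Ω.val p = 0 := by
  have h1 : Ω.inChart p = Ω.val := by
    funext y
    rw [TwoForm.inChart_eq]
    simp only [PartialEquiv.refl_symm, extChartAt_model_space_eq_id, PartialEquiv.refl_coe]
    rw [mder_id]
    ext v
    rfl
  rw [TwoForm.SmoothClosedAt, h1, extChartAt_model_space_eq_id] at h
  exact h

end SmoothClosed

/-! ### Local normal form and local sections of a submersion. -/

section Submersions

universe u

variable {E : Type u} [NormedAddCommGroup E] [NormedSpace ℝ E]
  {N : Type*} [TopologicalSpace N] [ChartedSpace E N]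
  {A : Type*} [NormedAddCommGroup A] [NormedSpace ℝ A]
  {X : Type*} [TopologicalSpace X] [ChartedSpace A X]
  {B : Type u} [NormedAddCommGroup B] [NormedSpace ℝ B]

/-- Local coordinates around `x` in which `π` is the projection `A × B → A`. -/
structure SubmersionBox (π : N → X) (x : N) (B : Type u) [NormedAddCommGroup B]
    [NormedSpace ℝ B] where
  toFun : N → A × B
  invFun : A × B → N
  base : X → A
  source : Set N
  target : Set (A × B)
  baseSource : Set X
  isOpen_source : IsOpen source
  mem_source : x ∈ source
  isOpen_target : IsOpen target
  mapsTo : MapsTo toFun source target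
  mapsTo_inv : MapsTo invFun target source
  left_inv : LeftInvOn invFun toFun source
  right_inv : LeftInvOn toFun invFun target
  contMDiffOn : ContMDiffOn 𝓘(ℝ, E) 𝓘(ℝ, A × B) ∞ toFun source
  contMDiffOn_inv : ContMDiffOn 𝓘(ℝ, A × B) 𝓘(ℝ, E) ∞ invFun target
  contMDiffAt_base : ContMDiffAt 𝓘(ℝ, A) 𝓘(ℝ, A) ∞ base (π x)
  base_apply : ∀ z ∈ target, base (π (invFun z)) = z.1
  baseSource_mem : baseSource ∈ 𝓝 (π x)
  injOn_base : InjOn base baseSource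
  mapsTo_baseSource : MapsTo π source baseSource

/-- The charts of the submersion normal form, with the linear splitting `E ≃ A × B` absorbed into
the upper chart. -/
theorem exists_submersionBox [IsManifold 𝓘(ℝ, E) ∞ N] [IsManifold 𝓘(ℝ, A) ∞ X] {π : N → X}
    (hπ : Manifold.IsSubmersion 𝓘(ℝ, E) 𝓘(ℝ, A) ∞ π) (x : N) :
    ∃ (B : Type u) (_ : NormedAddCommGroup B) (_ : NormedSpace ℝ B),
      Nonempty (SubmersionBox (E := E) (A := A) π x B) := by
  have h := hπ.isSubmersionAt x
  refine ⟨h.complement, inferInstance, inferInstance, ⟨?_⟩⟩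
  set φ := h.domChart.extend 𝓘(ℝ, E) with hφ
  set ψ := h.codChart.extend 𝓘(ℝ, A) with hψ
  have hφo : IsOpen φ.target := h.domChart.isOpen_extend_target
  exact
  { toFun := h.equiv ∘ φ
    invFun := φ.symm ∘ h.equiv.symm
    base := ψ
    source := φ.source
    target := h.equiv.symm ⁻¹' φ.target
    baseSource := ψ.source
    isOpen_source := by simpa [hφ] using h.domChart.open_source
    mem_source := by simpa [hφ] using h.mem_domChart_source
    isOpen_target := hφo.preimage h.equiv.symm.continuous
    mapsTo := fun y hy => by simpa using φ.map_source hy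
    mapsTo_inv := fun z hz => φ.map_target hz
    left_inv := fun y hy => by simpa using φ.left_inv hy
    right_inv := fun z hz => by
      simp only [Function.comp_apply]
      rw [φ.right_inv hz, ContinuousLinearEquiv.apply_symm_apply]
    contMDiffOn := by
      refine ContMDiff.comp_contMDiffOn (I' := 𝓘(ℝ, E)) (M' := E)
        h.equiv.contDiff.contMDiff ?_
      have := contMDiffOn_of_mem_maximalAtlas h.domChart_mem_maximalAtlas
      rw [hφ, OpenPartialHomeomorph.extend_source]
      exact this
    contMDiffOn_inv := by
      refine ContMDiffOn.comp (I' := 𝓘(ℝ, E)) (M' := E) (t := φ.target) ?_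
        h.equiv.symm.contDiff.contMDiff.contMDiffOn (fun z hz => hz)
      have := contMDiffOn_extend_symm (I := 𝓘(ℝ, E)) h.domChart_mem_maximalAtlas
      convert! this using 1
      simp [hφ]
    contMDiffAt_base := by
      have := contMDiffOn_of_mem_maximalAtlas h.codChart_mem_maximalAtlas
      exact this.contMDiffAt (h.codChart.open_source.mem_nhds h.mem_codChart_source)
    base_apply := fun z hz => by
      have := h.writtenInCharts hz
      simpa using! this
    baseSource_mem := by
      rw [hψ, OpenPartialHomeomorph.extend_source]
      exact h.codChart.open_source.mem_nhds h.mem_codChart_source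
    injOn_base := ψ.injOn
    mapsTo_baseSource := fun y hy => by
      rw [hψ, OpenPartialHomeomorph.extend_source]
      rw [hφ, OpenPartialHomeomorph.extend_source] at hy
      exact h.source_subset_preimage_source hy }

namespace SubmersionBox

variable {π : N → X} {x : N} (b : SubmersionBox (E := E) (A := A) π x B)

theorem toFun_mem : b.toFun x ∈ b.target := b.mapsTo b.mem_source

theorem contMDiffAt_inv {z : A × B} (hz : z ∈ b.target) :
    ContMDiffAt 𝓘(ℝ, A × B) 𝓘(ℝ, E) ∞ b.invFun z :=
  b.contMDiffOn_inv.contMDiffAt (b.isOpen_target.mem_nhds hz)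

theorem contMDiffAt_toFun {y : N} (hy : y ∈ b.source) :
    ContMDiffAt 𝓘(ℝ, E) 𝓘(ℝ, A × B) ∞ b.toFun y :=
  b.contMDiffOn.contMDiffAt (b.isOpen_source.mem_nhds hy)

/-- The local section through the centre of the box. -/
def localSection (q : X) : N := b.invFun (b.base q, (b.toFun x).2)

theorem base_eq {y : N} (hy : y ∈ b.source) : b.base (π y) = (b.toFun y).1 := by
  have := b.base_apply _ (b.mapsTo hy)
  rwa [b.left_inv hy] at this

theorem localSection_apply : b.localSection (π x) = x := by
  rw [localSection, b.base_eq b.mem_source]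
  exact b.left_inv b.mem_source

theorem contMDiffAt_localSection : ContMDiffAt 𝓘(ℝ, A) 𝓘(ℝ, E) ∞ b.localSection (π x) := by
  refine ContMDiffAt.comp (I' := 𝓘(ℝ, A × B)) (M' := A × B) (π x)
    (f := fun q => (b.base q, (b.toFun x).2)) ?_ ?_
  · apply b.contMDiffAt_inv
    rw [b.base_eq b.mem_source]
    exact b.toFun_mem
  · exact b.contMDiffAt_base.prodMk_space contMDiffAt_const

/-- Both points lie in `baseSource`, where `base` is injective, so they can be compared after
applying `base`. -/
theorem eventually_localSection : ∀ᶠ q in 𝓝 (π x), π (b.localSection q) = q := by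
  have h1 : ∀ᶠ q in 𝓝 (π x), (b.base q, (b.toFun x).2) ∈ b.target := by
    have hc : ContinuousAt (fun q => (b.base q, (b.toFun x).2)) (π x) :=
      b.contMDiffAt_base.continuousAt.prodMk continuousAt_const
    apply hc
    simp only [b.base_eq b.mem_source]
    exact b.isOpen_target.mem_nhds b.toFun_mem
  filter_upwards [h1, b.baseSource_mem] with q hq hq'
  exact b.injOn_base (b.mapsTo_baseSource (b.mapsTo_inv hq)) hq' (b.base_apply _ hq)

end SubmersionBox

/-- There are smooth local sections of `π` through every point. -/
def HasLocalSections (E : Type*) [NormedAddCommGroup E] [NormedSpace ℝ E]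
    {N : Type*} [TopologicalSpace N] [ChartedSpace E N]
    (A : Type*) [NormedAddCommGroup A] [NormedSpace ℝ A]
    {X : Type*} [TopologicalSpace X] [ChartedSpace A X] (π : N → X) : Prop :=
  ∀ x : N, ∃ s : X → N, ContMDiffAt 𝓘(ℝ, A) 𝓘(ℝ, E) ∞ s (π x) ∧ s (π x) = x ∧
    ∀ᶠ q in 𝓝 (π x), π (s q) = q

/-- Local sections are the form in which submersivity is used below: they give surjective
derivatives and smooth descent, and they restrict to level sets. -/
theorem hasLocalSections_of_isSubmersion [IsManifold 𝓘(ℝ, E) ∞ N] [IsManifold 𝓘(ℝ, A) ∞ X]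
    {π : N → X} (hπ : Manifold.IsSubmersion 𝓘(ℝ, E) 𝓘(ℝ, A) ∞ π) : HasLocalSections E A π := by
  intro x
  obtain ⟨B, _, _, ⟨b⟩⟩ := exists_submersionBox hπ x
  exact ⟨b.localSection, b.contMDiffAt_localSection, b.localSection_apply,
    b.eventually_localSection⟩

end Submersions

/-! ### Descent of smooth maps, and constancy along leaves. -/

section Descent

variable {E : Type*} [NormedAddCommGroup E] [NormedSpace ℝ E]
  {N : Type*} [TopologicalSpace N] [ChartedSpace E N]
  {A : Type*} [NormedAddCommGroup A] [NormedSpace ℝ A]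
  {X : Type*} [TopologicalSpace X] [ChartedSpace A X]
  {C : Type*} [NormedAddCommGroup C] [NormedSpace ℝ C]
  {Y : Type*} [TopologicalSpace Y] [ChartedSpace C Y] {π : N → X}

theorem HasLocalSections.mder_surjective (h : HasLocalSections E A π)
    (hπ : ContMDiff 𝓘(ℝ, E) 𝓘(ℝ, A) ∞ π) (x : N) :
    Function.Surjective (mder (E := E) (E' := A) π x) := by
  obtain ⟨s, hs, hsx, he⟩ := h x
  have h1 : mder (E := A) (E' := A) (π ∘ s) (π x) = ContinuousLinearMap.id ℝ A := by
    rw [mder_congr (f := π ∘ s) (g := id) he, mder_id]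
  rw [mder_comp (hπ.mdifferentiable (by simp) _) (hs.mdifferentiableAt (by simp)), hsx] at h1
  intro v
  exact ⟨mder (E := A) (E' := E) s (π x) v, congrArg (fun L => L v) h1⟩

/-- Near `π x` one has `g = (g ∘ π) ∘ s` for a local section `s`. -/
theorem HasLocalSections.contMDiffAt_of_comp (h : HasLocalSections E A π) {g : X → Y} {x : N}
    (hg : ContMDiffAt 𝓘(ℝ, E) 𝓘(ℝ, C) ∞ (g ∘ π) x) :
    ContMDiffAt 𝓘(ℝ, A) 𝓘(ℝ, C) ∞ g (π x) := by
  obtain ⟨s, hs, hsx, he⟩ := h x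
  rw [← hsx] at hg
  refine (hg.comp (π x) hs).congr_of_eventuallyEq ?_
  filter_upwards [he] with q hq
  simp [hq]

theorem HasLocalSections.contMDiff_of_comp (h : HasLocalSections E A π)
    (hsurj : Function.Surjective π) {g : X → Y}
    (hg : ContMDiff 𝓘(ℝ, E) 𝓘(ℝ, C) ∞ (g ∘ π)) :
    ContMDiff 𝓘(ℝ, A) 𝓘(ℝ, C) ∞ g := by
  intro q
  obtain ⟨x, rfl⟩ := hsurj q
  exact h.contMDiffAt_of_comp (hg x)

/-- A curve in a manifold with vanishing velocity is constant. -/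
theorem eq_of_mder_eq_zero [IsManifold 𝓘(ℝ, A) ∞ X] {c : ℝ → X}
    (hc : MDifferentiable 𝓘(ℝ, ℝ) 𝓘(ℝ, A) c)
    (h0 : ∀ t, mder (E := ℝ) (E' := A) c t 1 = 0) (s t : ℝ) : c s = c t := by
  have hz : ∀ t, mder (E := ℝ) (E' := A) c t = 0 := fun t => by
    ext; simpa using h0 t
  have hl : IsLocallyConstant c := by
    rw [IsLocallyConstant.iff_eventually_eq]
    intro t
    have hcont : ContinuousAt c t := (hc t).continuousAt
    have hsrc : ∀ᶠ r in 𝓝 t, c r ∈ (extChartAt 𝓘(ℝ, A) (c t)).source :=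
      hcont (extChartAt_source_mem_nhds (c t))
    obtain ⟨ε, hε, hball⟩ := Metric.eventually_nhds_iff_ball.1 hsrc
    have hd : ∀ r ∈ Metric.ball t ε,
        HasFDerivAt (extChartAt 𝓘(ℝ, A) (c t) ∘ c) (0 : ℝ →L[ℝ] A) r := by
      intro r hr
      have hψ : MDifferentiableAt 𝓘(ℝ, A) 𝓘(ℝ, A) (extChartAt 𝓘(ℝ, A) (c t)) (c r) :=
        ((contMDiffOn_extChartAt (n := ∞) (x := c t)).contMDiffAt
          ((chartAt A (c t)).open_source.mem_nhds
            (by simpa using hball r hr))).mdifferentiableAt (by simp)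
      have h2 := (hψ.comp r (hc r)).differentiableAt.hasFDerivAt
      rw [← mder_eq_fderiv, mder_comp hψ (hc r), hz, ContinuousLinearMap.comp_zero] at h2
      exact h2
    filter_upwards [Metric.ball_mem_nhds t hε] with r hr
    have := (convex_ball t ε).is_const_of_fderivWithin_eq_zero (𝕜 := ℝ)
      (f := extChartAt 𝓘(ℝ, A) (c t) ∘ c)
      (fun r hr => (hd r hr).differentiableAt.differentiableWithinAt)
      (fun r hr => by
        rw [fderivWithin_of_isOpen Metric.isOpen_ball hr, (hd r hr).fderiv])
      hr (Metric.mem_ball_self hε)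
    exact (extChartAt 𝓘(ℝ, A) (c t)).injOn (hball r hr) (hball t (Metric.mem_ball_self hε)) this
  exact hl.apply_eq_of_isPreconnected isPreconnected_univ (mem_univ _) (mem_univ _)

/-- A map whose derivative vanishes on `ker α` is constant on the leaves of `ker α`. -/
theorem eq_of_leafProj_eq [IsManifold 𝓘(ℝ, A) ∞ X] {α : TwoForm E N} {f : N → X}
    (hf : MDifferentiable 𝓘(ℝ, E) 𝓘(ℝ, A) f)
    (h0 : ∀ x, ∀ v : E, v ∈ α.kerAt x → mder (E := E) (E' := A) f x v = 0) {p q : N}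
    (h : leafProj α p = leafProj α q) : f p = f q := by
  have h1 : Relation.EqvGen (KerJoined α) p q := Quotient.exact h
  clear h
  induction h1 with
  | refl => rfl
  | symm _ _ _ ih => exact ih.symm
  | trans _ _ _ _ _ ih1 ih2 => exact ih1.trans ih2
  | rel p q h =>
    obtain ⟨γ, hγ, rfl, rfl, hk⟩ := h
    have hγd : MDifferentiable 𝓘(ℝ, ℝ) 𝓘(ℝ, E) γ := hγ.mdifferentiable (by simp)
    refine eq_of_mder_eq_zero (A := A) (c := f ∘ γ) (hf.comp hγd) (fun t => ?_) 0 1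
    rw [mder_comp (hf _) (hγd t)]
    exact h0 _ _ (hk t)

end Descent

/-! ### Descent of a closed 2-form to the leaf space of its kernel. -/

section FormDescent

universe u

/-- Cartan's formula for the constant field `v`: the Lie derivative is `i_v dα + d(i_v α)`, and both
terms vanish at `z`. -/
theorem fderiv_eq_zero_of_extDeriv_eq_zero {V : Type*} [NormedAddCommGroup V] [NormedSpace ℝ V]
    {α : V → V [⋀^Fin 2]→L[ℝ] ℝ} {z v : V} (hd : DifferentiableAt ℝ α z) (hc : extDeriv α z = 0)
    (hv : ∀ᶠ y in 𝓝 z, ∀ w, α y ![v, w] = 0) (v₁ v₂ : V) :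
    fderiv ℝ (fun y => α y ![v₁, v₂]) z v = 0 := by
  have h := extDeriv_apply hd ![v, v₁, v₂]
  rw [hc] at h
  have r0 : (0 : Fin 3).removeNth ![v, v₁, v₂] = ![v₁, v₂] := by
    ext i; fin_cases i <;> rfl
  have r1 : (1 : Fin 3).removeNth ![v, v₁, v₂] = ![v, v₂] := by
    ext i; fin_cases i <;> rfl
  have r2 : (2 : Fin 3).removeNth ![v, v₁, v₂] = ![v, v₁] := by
    ext i; fin_cases i <;> rfl
  have f1 : fderiv ℝ (fun y => α y ![v, v₂]) z = 0 := by
    have : (fun y => α y ![v, v₂]) =ᶠ[𝓝 z] fun _ => (0 : ℝ) := hv.mono fun y hy => hy _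
    rw [this.fderiv_eq]; simp
  have f2 : fderiv ℝ (fun y => α y ![v, v₁]) z = 0 := by
    have : (fun y => α y ![v, v₁]) =ᶠ[𝓝 z] fun _ => (0 : ℝ) := hv.mono fun y hy => hy _
    rw [this.fderiv_eq]; simp
  rw [Fin.sum_univ_three, r0, r1, r2, f1, f2] at h
  simpa using h.symm

/-- A closed form killed by the second factor does not depend on the second coordinate. -/
theorem eventually_eq_of_extDeriv_eq_zero {A B : Type*} [NormedAddCommGroup A] [NormedSpace ℝ A]
    [NormedAddCommGroup B] [NormedSpace ℝ B] {α : A × B → (A × B) [⋀^Fin 2]→L[ℝ] ℝ}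
    {W : Set (A × B)} (hW : IsOpen W) (hd : ∀ z ∈ W, DifferentiableAt ℝ α z)
    (hc : ∀ z ∈ W, extDeriv α z = 0) (hv : ∀ z ∈ W, ∀ (b : B) w, α z ![(0, b), w] = 0)
    {z₀ : A × B} (hz₀ : z₀ ∈ W) :
    ∀ᶠ z in 𝓝 z₀, (z.1, z₀.2) ∈ W ∧ α z = α (z.1, z₀.2) := by
  obtain ⟨r, hr, hball⟩ := Metric.isOpen_iff.1 hW z₀ hz₀
  filter_upwards [Metric.ball_mem_nhds z₀ hr] with z hz
  -- A sup-norm ball is a product of balls, so its slices over `z.1` are convex.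
  rw [← Prod.mk.eta (p := z₀), ← ball_prod_same] at hball
  have hz' : z.1 ∈ Metric.ball z₀.1 r ∧ z.2 ∈ Metric.ball z₀.2 r := by
    rwa [← Prod.mk.eta (p := z₀), ← ball_prod_same] at hz
  have hm : ∀ b ∈ Metric.ball z₀.2 r, (z.1, b) ∈ W := fun b hb => hball ⟨hz'.1, hb⟩
  refine ⟨hm _ (Metric.mem_ball_self hr), ?_⟩
  ext v
  have hvv : v = ![v 0, v 1] := by ext i <;> fin_cases i <;> rfl
  rw [hvv]
  have hD : ∀ b ∈ Metric.ball z₀.2 r,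
      HasFDerivAt (fun b => α (z.1, b) ![v 0, v 1]) (0 : B →L[ℝ] ℝ) b := by
    intro b hb
    have hdz : DifferentiableAt ℝ (fun y => α y ![v 0, v 1]) (z.1, b) :=
      (hd _ (hm b hb)).continuousAlternatingMap_apply_const _
    have h1 := hdz.hasFDerivAt.comp b (hasFDerivAt_prodMk_right z.1 b)
    convert! h1 using 1
    ext w
    exact (fderiv_eq_zero_of_extDeriv_eq_zero (hd _ (hm b hb)) (hc _ (hm b hb))
      (by filter_upwards [hW.mem_nhds (hm b hb)] with y hy using hv y hy w) _ _).symm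
  have := (convex_ball z₀.2 r).is_const_of_fderivWithin_eq_zero (𝕜 := ℝ)
    (fun b hb => (hD b hb).differentiableAt.differentiableWithinAt)
    (fun b hb => by rw [fderivWithin_of_isOpen Metric.isOpen_ball hb, (hD b hb).fderiv])
    hz'.2 (Metric.mem_ball_self hr)
  exact this

variable {E : Type u} [NormedAddCommGroup E] [NormedSpace ℝ E]
  {N : Type*} [TopologicalSpace N] [ChartedSpace E N]
  {A : Type*} [NormedAddCommGroup A] [NormedSpace ℝ A]
  {X : Type*} [TopologicalSpace X] [ChartedSpace A X]
  {B : Type u} [NormedAddCommGroup B] [NormedSpace ℝ B]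

theorem eventually_mdifferentiableAt [IsManifold 𝓘(ℝ, E) ∞ N] [IsManifold 𝓘(ℝ, A) ∞ X]
    {f : N → X} {x : N}
    (hf : ContMDiffAt 𝓘(ℝ, E) 𝓘(ℝ, A) ∞ f x) :
    ∀ᶠ y in 𝓝 x, MDifferentiableAt 𝓘(ℝ, E) 𝓘(ℝ, A) f y := by
  have h1 : ContMDiffAt 𝓘(ℝ, E) 𝓘(ℝ, A) 1 f x := hf.of_le (by simp)
  exact ((contMDiffAt_iff_contMDiffAt_nhds (by simp)).1 h1).mono fun y hy =>
    hy.mdifferentiableAt (by simp)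

/-- Near `z` the map `π ∘ invFun` is unchanged by freezing the second coordinate, and the derivative
of that freezing kills `(0, v)`. -/
theorem SubmersionBox.mder_mder_inv {π : N → X} {x : N}
    (hπ : ContMDiff 𝓘(ℝ, E) 𝓘(ℝ, A) ∞ π)
    (b : SubmersionBox (E := E) (A := A) π x B) {z : A × B} (hz : z ∈ b.target) (v : B) :
    mder (E := E) (E' := A) π (b.invFun z)
      (mder (E := A × B) (E' := E) b.invFun z ((0, v) : A × B)) = 0 := by
  have hi : MDifferentiableAt 𝓘(ℝ, A × B) 𝓘(ℝ, E) b.invFun z :=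
    (b.contMDiffAt_inv hz).mdifferentiableAt (by simp)
  have hp : MDifferentiableAt 𝓘(ℝ, E) 𝓘(ℝ, A) π (b.invFun z) := hπ.mdifferentiable (by simp) _
  have hpi := hp.comp z hi
  let c : A × B → A × B := fun y => (y.1, z.2)
  have hcd : HasFDerivAt c ((ContinuousLinearMap.fst ℝ A B).prod 0) z :=
    (ContinuousLinearMap.fst ℝ A B).hasFDerivAt.prodMk (hasFDerivAt_const z.2 z)
  have hc : MDifferentiableAt 𝓘(ℝ, A × B) 𝓘(ℝ, A × B) c z :=
    hcd.differentiableAt.mdifferentiableAt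
  have heq : (π ∘ b.invFun) =ᶠ[𝓝 z] (π ∘ b.invFun) ∘ c := by
    have hcz : ∀ᶠ y in 𝓝 z, c y ∈ b.target :=
      hcd.continuousAt (b.isOpen_target.mem_nhds hz)
    filter_upwards [hcz, b.isOpen_target.mem_nhds hz] with y hy hy'
    apply b.injOn_base (b.mapsTo_baseSource (b.mapsTo_inv hy'))
      (b.mapsTo_baseSource (b.mapsTo_inv hy))
    exact (b.base_apply _ hy').trans (b.base_apply _ hy).symm
  have h1 := DFunLike.congr_fun (mder_congr (E := A × B) (E' := A) heq) ((0, v) : A × B)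
  rw [mder_comp (x := z) (f := c) (g := π ∘ b.invFun) hpi hc, mder_comp hp hi, mder_eq_fderiv,
    hcd.fderiv] at h1
  refine h1.trans ?_
  have : ((ContinuousLinearMap.fst ℝ A B).prod (0 : A × B →L[ℝ] B)) ((0, v) : A × B) = 0 := rfl
  rw [ContinuousLinearMap.comp_apply, this, map_zero]

/-- A closed form annihilated by `ker dπ` is locally the pull-back of a form on the base. -/
theorem exists_local_form [IsManifold 𝓘(ℝ, E) ∞ N] [IsManifold 𝓘(ℝ, A) ∞ X] {π : N → X}
    (hπ : Manifold.IsSubmersion 𝓘(ℝ, E) 𝓘(ℝ, A) ∞ π) {Ω : TwoForm E N}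
    (hΩ : ∀ p, Ω.SmoothClosedAt p)
    (hk : ∀ (y : N) (v : E), mder (E := E) (E' := A) π y v = 0 → v ∈ Ω.kerAt y) (x : N) :
    ∃ σ : TwoForm A X, σ.SmoothClosedAt (π x) ∧ ∀ᶠ y in 𝓝 x,
      Ω.val y = (σ.val (π y)).compContinuousLinearMap (mder (E := E) (E' := A) π y) := by
  obtain ⟨B, _, _, ⟨b⟩⟩ := exists_submersionBox hπ x
  have hπs : ContMDiff 𝓘(ℝ, E) 𝓘(ℝ, A) ∞ π := hπ.contMDiff
  -- The base form is the restriction of `Ω` to the slice through `x`. In box coordinates `Ω`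
  -- neither depends on nor sees the second factor, so the slice determines it.
  refine ⟨TwoForm.pullback (E := A) b.localSection Ω,
    (hΩ _).pullback b.contMDiffAt_localSection, ?_⟩
  let α : TwoForm (A × B) (A × B) := TwoForm.pullback (E := A × B) b.invFun Ω
  have hα : ∀ z ∈ b.target, ContDiffAt ℝ ∞ α.val z ∧ extDeriv α.val z = 0 := fun z hz =>
    TwoForm.SmoothClosedAt.modelSpace ((hΩ _).pullback (b.contMDiffAt_inv hz))
  have hkill : ∀ z ∈ b.target, ∀ (v : B) w, α.val z ![(0, v), w] = 0 := by
    intro z hz v w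
    rw [TwoForm.val_pullback, compContinuousLinearMap_apply_two]
    exact hk _ _ (b.mder_mder_inv hπs hz v) _
  have h1 := eventually_eq_of_extDeriv_eq_zero b.isOpen_target
    (fun z hz => (hα z hz).1.differentiableAt (by simp)) (fun z hz => (hα z hz).2) hkill b.toFun_mem
  have h2 := (b.contMDiffAt_toFun b.mem_source).continuousAt.eventually h1
  have h3 := hπs.continuous.continuousAt.eventually
    (eventually_mdifferentiableAt b.contMDiffAt_localSection)
  filter_upwards [h2, h3, b.isOpen_source.mem_nhds b.mem_source] with y hy hs hyU
  have hyW : b.toFun y ∈ b.target := b.mapsTo hyU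
  have hΦ : MDifferentiableAt 𝓘(ℝ, E) 𝓘(ℝ, A × B) b.toFun y :=
    (b.contMDiffAt_toFun hyU).mdifferentiableAt (by simp)
  have hΘ : ∀ z ∈ b.target, MDifferentiableAt 𝓘(ℝ, A × B) 𝓘(ℝ, E) b.invFun z := fun z hz =>
    (b.contMDiffAt_inv hz).mdifferentiableAt (by simp)
  let C : A × B →L[ℝ] A × B := (ContinuousLinearMap.fst ℝ A B).prod 0
  let c : A × B → A × B := fun y => (y.1, (b.toFun x).2)
  have hcd : ∀ z, HasFDerivAt c C z := fun z =>
    (ContinuousLinearMap.fst ℝ A B).hasFDerivAt.prodMk (hasFDerivAt_const _ z)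
  have e1 : Ω.val y = (α.val (b.toFun y)).compContinuousLinearMap
      (mder (E := E) (E' := A × B) b.toFun y) := by
    rw [TwoForm.val_pullback, ← compContinuousLinearMap_comp, ← mder_comp (hΘ _ hyW) hΦ,
      mder_congr (f := b.invFun ∘ b.toFun) (g := id), mder_id, b.left_inv hyU]
    · ext v; rfl
    · filter_upwards [b.isOpen_source.mem_nhds hyU] with w hw using b.left_inv hw
  -- `α` annihilates the second factor in each argument, so projecting the arguments to `A` changes
  -- nothing.
  have e2 : (α.val (c (b.toFun y))).compContinuousLinearMap C = α.val (c (b.toFun y)) := by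
    ext v
    have hvv : v = ![v 0, v 1] := by ext i <;> fin_cases i <;> rfl
    have hdec : ∀ w : A × B, C w + ((0, w.2) : A × B) = w := fun w => by
      ext <;> simp [C]
    have hl : ∀ p w : A × B, (α.val (c (b.toFun y))) ![C p, w] =
        (α.val (c (b.toFun y))) ![p, w] := fun p w => by
      have := ((α.val (c (b.toFun y))).toMultilinearMap.cons_add ![w] (C p) (0, p.2))
      rw [hdec] at this
      change (α.val (c (b.toFun y))) ![p, w] = (α.val (c (b.toFun y))) ![C p, w] +
        (α.val (c (b.toFun y))) ![(0, p.2), w] at this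
      rw [this, hkill _ hy.1, add_zero]
    have hsw : ∀ p w : A × B, (α.val (c (b.toFun y))) ![p, w] =
        - (α.val (c (b.toFun y))) ![w, p] := fun p w => by
      have := (α.val (c (b.toFun y))).toAlternatingMap.map_swap ![w, p]
        (i := 0) (j := 1) (by decide)
      have h' : ![w, p] ∘ Equiv.swap (0 : Fin 2) 1 = ![p, w] := by
        ext i <;> fin_cases i <;> simp
      rw [h'] at this
      exact this
    rw [hvv, compContinuousLinearMap_apply_two, hl, hsw, hl, ← hsw]
  have e3 : (mder (E := A) (E' := E) b.localSection (π y)).comp (mder (E := E) (E' := A) π y) =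
      (mder (E := A × B) (E' := E) b.invFun (c (b.toFun y))).comp
        (C.comp (mder (E := E) (E' := A × B) b.toFun y)) := by
    have hcm : MDifferentiableAt 𝓘(ℝ, A × B) 𝓘(ℝ, A × B) c (b.toFun y) :=
      (hcd _).differentiableAt.mdifferentiableAt
    rw [← (hcd (b.toFun y)).fderiv, ← mder_eq_fderiv, ← mder_comp hcm hΦ,
      ← mder_comp hs (hπs.mdifferentiable (by simp) y)]
    refine Eq.trans (mder_congr ?_)
      (mder_comp (g := b.invFun) (f := c ∘ b.toFun) (hΘ _ hy.1) (hcm.comp y hΦ))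
    filter_upwards [b.isOpen_source.mem_nhds hyU] with w hw
    simp only [Function.comp_apply, SubmersionBox.localSection, b.base_eq hw, c]
  have e4 : b.localSection (π y) = b.invFun (c (b.toFun y)) := by
    simp only [SubmersionBox.localSection, b.base_eq hyU, c]
  rw [TwoForm.val_pullback, ← compContinuousLinearMap_comp, e3, e4, e1, hy.2, ← e2]
  rfl

/-- A smooth closed form descends to the space of leaves of its kernel. -/
theorem exists_form_on_leafSpace [IsManifold 𝓘(ℝ, E) ∞ N] {Ω : TwoForm E N}
    [ChartedSpace A (LeafSpace Ω)] [IsManifold 𝓘(ℝ, A) ∞ (LeafSpace Ω)]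
    (hq : IsLeafQuotient (E' := A) Ω) (hΩ : ∀ p, Ω.SmoothClosedAt p) :
    ∃ σ : TwoForm A (LeafSpace Ω), (∀ q, σ.SmoothClosedAt q) ∧
      TwoForm.pullback (leafProj Ω) σ = Ω := by
  have hsm : ContMDiff 𝓘(ℝ, E) 𝓘(ℝ, A) ∞ (leafProj Ω) := hq.submersion.contMDiff
  have hls := hasLocalSections_of_isSubmersion hq.submersion
  have hsurj := hls.mder_surjective hsm
  choose σ hσ hσe using exists_local_form hq.submersion hΩ (fun y v h => (hq.ker_mfderiv y v).1 h)
  -- `τ x` is the only form on the tangent space of the quotient that pulls back to `Ω` at `x`.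
  -- Hence it agrees near `x` with `σ x` composed with the projection.
  let τ : N → A [⋀^Fin 2]→L[ℝ] ℝ := fun x => (σ x).val (leafProj Ω x)
  have hτ : ∀ x, Ω.val x = (τ x).compContinuousLinearMap
      (mder (E := E) (E' := A) (leafProj Ω) x) := fun x => (hσe x).self_of_nhds
  have hnear : ∀ x, ∀ᶠ y in 𝓝 x, τ y = (σ x).val (leafProj Ω y) := fun x => by
    filter_upwards [hσe x] with y hy
    exact compContinuousLinearMap_injective (hsurj y) ((hτ y).symm.trans hy)
  have hinv : ∀ x y, leafProj Ω x = leafProj Ω y → τ x = τ y := by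
    intro x y h
    have h1 : Relation.EqvGen (KerJoined Ω) x y := Quotient.exact h
    clear h
    induction h1 with
    | refl => rfl
    | symm _ _ _ ih => exact ih.symm
    | trans _ _ _ _ _ ih1 ih2 => exact ih1.trans ih2
    | rel p q h =>
      obtain ⟨γ, hγ, rfl, rfl, hk⟩ := h
      have hγd : MDifferentiable 𝓘(ℝ, ℝ) 𝓘(ℝ, E) γ := hγ.mdifferentiable (by simp)
      have hπd : MDifferentiable 𝓘(ℝ, E) 𝓘(ℝ, A) (leafProj Ω) := hsm.mdifferentiable (by simp)
      have hconst : ∀ s t, leafProj Ω (γ s) = leafProj Ω (γ t) :=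
        eq_of_mder_eq_zero (A := A) (c := leafProj Ω ∘ γ) (hπd.comp hγd) fun t => by
          rw [mder_comp (hπd _) (hγd t)]
          exact (hq.ker_mfderiv _ _).2 (hk t)
      -- Near time `t`, `τ ∘ γ` is one fixed local form evaluated at the fixed point `leafProj Ω (γ
      -- t)`.
      have hl : IsLocallyConstant (τ ∘ γ) := by
        rw [IsLocallyConstant.iff_eventually_eq]
        intro t
        filter_upwards [hγ.continuous.continuousAt.eventually (hnear (γ t))] with s hs
        rw [Function.comp_apply, hs, hconst s t]
        rfl
      exact hl.apply_eq_of_isPreconnected isPreconnected_univ (mem_univ _) (mem_univ _)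
  let σr : TwoForm A (LeafSpace Ω) := fun q => τ q.out
  have hval : ∀ x, σr.val (leafProj Ω x) = τ x := fun x =>
    hinv _ _ (Quotient.out_eq (leafProj Ω x))
  refine ⟨σr, fun q => ?_, TwoForm.ext_val fun x => ?_⟩
  · obtain ⟨x, rfl⟩ : ∃ x, leafProj Ω x = q := Quotient.exists_rep q
    refine (hσ x).congr ?_
    obtain ⟨s, hs, hsx, he⟩ := hls x
    have hn := hnear x
    rw [← hsx] at hn
    filter_upwards [hs.continuousAt.eventually hn, he] with q h1 h2
    rw [hsx] at h1
    rw [← h2, hval, h1]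
  · rw [TwoForm.val_pullback, hval, ← hτ]

/-- A form on the space of leaves which pulls back to `Ω` is nondegenerate. -/
theorem kerAt_eq_bot_of_pullback [IsManifold 𝓘(ℝ, E) ∞ N] {Ω : TwoForm E N}
    [ChartedSpace A (LeafSpace Ω)] [IsManifold 𝓘(ℝ, A) ∞ (LeafSpace Ω)]
    (hq : IsLeafQuotient (E' := A) Ω) {σ : TwoForm A (LeafSpace Ω)}
    (hσ : TwoForm.pullback (leafProj Ω) σ = Ω) (q : LeafSpace Ω) : σ.kerAt q = ⊥ := by
  obtain ⟨x, rfl⟩ : ∃ x, leafProj Ω x = q := Quotient.exists_rep q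
  have hsurj := (hasLocalSections_of_isSubmersion hq.submersion).mder_surjective
    hq.submersion.contMDiff x
  refine (Submodule.eq_bot_iff _).2 fun v hv => ?_
  obtain ⟨u, rfl⟩ := hsurj v
  refine (hq.ker_mfderiv x u).2 fun (w : E) => ?_
  have h1 : Ω.val x = _ := congrArg (fun α : TwoForm E N => α.val x) hσ.symm
  change Ω.val x ![u, w] = 0
  rw [h1, TwoForm.val_pullback, compContinuousLinearMap_apply_two]
  exact hv _

end FormDescent

/-! ### Extension of vertical vectors to vertical vector fields. -/

section VectorFields

open VectorField

universe u

variable {E : Type u} [NormedAddCommGroup E] [NormedSpace ℝ E]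
  {M : Type*} [TopologicalSpace M] [ChartedSpace E M]
  {A : Type*} [NormedAddCommGroup A] [NormedSpace ℝ A]
  {X : Type*} [TopologicalSpace X] [ChartedSpace A X]

/-- A vertical tangent vector of a submersion extends to a smooth vertical vector field. -/
theorem exists_vertical_vectorField [FiniteDimensional ℝ E] [T2Space M]
    [IsManifold 𝓘(ℝ, E) ∞ M] [IsManifold 𝓘(ℝ, A) ∞ X] {π : M → X}
    (hπ : Manifold.IsSubmersion 𝓘(ℝ, E) 𝓘(ℝ, A) ∞ π) (x : M) (v : E)
    (hv : mder (E := E) (E' := A) π x v = 0) :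
    ∃ Z : ∀ y : M, TangentSpace 𝓘(ℝ, E) y, IsSmoothVectorField Z ∧ Z x = v ∧
      ∀ y, mder (E := E) (E' := A) π y (Z y) = 0 := by
  obtain ⟨B, _, _, ⟨b⟩⟩ := exists_submersionBox hπ x
  have hπs : ContMDiff 𝓘(ℝ, E) 𝓘(ℝ, A) ∞ π := hπ.contMDiff
  obtain ⟨ψ, -, hψ⟩ := ((SmoothBumpFunction.nhds_basis_tsupport (I := 𝓘(ℝ, E)) x).mem_iff).1
    (b.isOpen_source.mem_nhds b.mem_source)
  have hΦ : ∀ y ∈ b.source, MDifferentiableAt 𝓘(ℝ, E) 𝓘(ℝ, A × B) b.toFun y := fun y hy =>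
    (b.contMDiffAt_toFun hy).mdifferentiableAt (by simp)
  have hΘ : ∀ z ∈ b.target, MDifferentiableAt 𝓘(ℝ, A × B) 𝓘(ℝ, E) b.invFun z := fun z hz =>
    (b.contMDiffAt_inv hz).mdifferentiableAt (by simp)
  have hl : ∀ y ∈ b.source, (mder (E := A × B) (E' := E) b.invFun (b.toFun y)).comp
      (mder (E := E) (E' := A × B) b.toFun y) = ContinuousLinearMap.id ℝ E := fun y hy => by
    rw [← mder_comp (hΘ _ (b.mapsTo hy)) (hΦ y hy),
      mder_congr (f := b.invFun ∘ b.toFun) (g := id), mder_id]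
    filter_upwards [b.isOpen_source.mem_nhds hy] with w hw using b.left_inv hw
  have hr : ∀ y ∈ b.source, (mder (E := E) (E' := A × B) b.toFun y).comp
      (mder (E := A × B) (E' := E) b.invFun (b.toFun y)) =
        ContinuousLinearMap.id ℝ (A × B) := fun y hy => by
    have h1 := hΦ y hy
    have h2 := mder_comp (E := A × B) (E'' := A × B) (g := b.toFun) (f := b.invFun)
      (x := b.toFun y) (by rwa [b.left_inv hy]) (hΘ _ (b.mapsTo hy))
    rw [b.left_inv hy] at h2
    rw [← h2, mder_congr (f := b.toFun ∘ b.invFun) (g := id), mder_id]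
    filter_upwards [b.isOpen_target.mem_nhds (b.mapsTo hy)] with w hw using b.right_inv hw
  have hinv : ∀ y ∈ b.source,
      (mfderiv 𝓘(ℝ, E) 𝓘(ℝ, A × B) b.toFun y).IsInvertible := fun y hy =>
    ContinuousLinearMap.IsInvertible.of_inverse (hr y hy) (hl y hy)
  have hinveq : ∀ y ∈ b.source, (mfderiv 𝓘(ℝ, E) 𝓘(ℝ, A × B) b.toFun y).inverse =
      mder (E := A × B) (E' := E) b.invFun (b.toFun y) := fun y hy =>
    ContinuousLinearMap.inverse_eq (hr y hy) (hl y hy)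
  let w : A × B := mder (E := E) (E' := A × B) b.toFun x v
  have hw1 : w.1 = 0 := by
    have h1 : (ContinuousLinearMap.fst ℝ A B) ∘ b.toFun =ᶠ[𝓝 x] b.base ∘ π := by
      filter_upwards [b.isOpen_source.mem_nhds b.mem_source] with y hy
      exact (b.base_eq hy).symm
    have h2 := DFunLike.congr_fun (mder_congr (E := E) (E' := A) h1) v
    rw [mder_comp (b.contMDiffAt_base.mdifferentiableAt (by simp))
      (hπs.mdifferentiable (by simp) x),
      mder_comp (ContinuousLinearMap.fst ℝ A B).differentiableAt.mdifferentiableAt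
        (hΦ x b.mem_source), mder_eq_fderiv, ContinuousLinearMap.fderiv,
      ContinuousLinearMap.comp_apply, ContinuousLinearMap.comp_apply, hv, map_zero] at h2
    exact h2
  have hw : w = ((0, w.2) : A × B) := by rw [← hw1]
  -- The extension is the constant vertical field of the box, pulled back to `M` and cut off by the
  -- bump function `ψ`.
  let V : ∀ z : A × B, TangentSpace 𝓘(ℝ, A × B) z := fun _ => w
  let Y : ∀ y : M, TangentSpace 𝓘(ℝ, E) y := mpullback 𝓘(ℝ, E) 𝓘(ℝ, A × B) b.toFun V
  have hY : ∀ y ∈ b.source, Y y = mder (E := A × B) (E' := E) b.invFun (b.toFun y) w :=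
    fun y hy => by
      change (mfderiv 𝓘(ℝ, E) 𝓘(ℝ, A × B) b.toFun y).inverse w = _
      exact DFunLike.congr_fun (hinveq y hy) w
  refine ⟨fun y => ψ y • Y y, ?_, ?_, fun y => ?_⟩
  · have hV : ContMDiff 𝓘(ℝ, A × B) 𝓘(ℝ, A × B).tangent ∞
        (fun z => (⟨z, V z⟩ : TangentBundle 𝓘(ℝ, A × B) (A × B))) :=
      contMDiff_vectorSpace_iff_contDiff.2 contDiff_const
    refine ContMDiffOn.smul_section_of_tsupport (V := fun y : M => TangentSpace 𝓘(ℝ, E) y)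
      (s := Y) (ψ.contMDiff.contMDiffOn) b.isOpen_source hψ fun y hy => ?_
    exact (ContMDiffAt.mpullback_vectorField_preimage (hV _) (b.contMDiffAt_toFun hy)
      (hinv y hy) (by simp)).contMDiffWithinAt
  · have : ψ x = 1 := ψ.eq_one
    simp only [this, one_smul]
    rw [hY x b.mem_source]
    exact DFunLike.congr_fun (hl x b.mem_source) v
  · by_cases hy : y ∈ b.source
    · have h1 := b.mder_mder_inv hπs (b.mapsTo hy) w.2
      rw [← hw, b.left_inv hy] at h1
      have h2 : mder (E := E) (E' := A) π y (ψ y • Y y : E) =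
        ψ y • mder (E := E) (E' := A) π y (Y y) := map_smul _ _ _
      refine h2.trans ?_
      rw [hY y hy, h1, smul_zero]
    · have : ψ y = 0 := by
        by_contra hne
        exact hy (hψ (subset_tsupport _ hne))
      have h2 : (ψ y • Y y : E) = 0 := by rw [this]; exact zero_smul ℝ (Y y : E)
      exact (congrArg _ h2).trans (map_zero _)

end VectorFields

/-! ### Lie brackets of related vector fields. -/

section LieBracket

open VectorField

variable {E : Type*} [NormedAddCommGroup E] [NormedSpace ℝ E]
  {M : Type*} [TopologicalSpace M] [ChartedSpace E M] [IsManifold 𝓘(ℝ, E) ∞ M]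
  {E' : Type*} [NormedAddCommGroup E'] [NormedSpace ℝ E'] [CompleteSpace E']
  {M' : Type*} [TopologicalSpace M'] [ChartedSpace E' M'] [IsManifold 𝓘(ℝ, E') ∞ M']

/-- The expression of a vector field in the preferred chart at `x`. -/
def fieldInChart (V : ∀ y : M, TangentSpace 𝓘(ℝ, E) y) (x : M) : E → E :=
  mpullbackWithin 𝓘(ℝ, E) 𝓘(ℝ, E) (extChartAt 𝓘(ℝ, E) x).symm V (range 𝓘(ℝ, E))

theorem mder_extChartAt_symm_fieldInChart (V : ∀ y : M, TangentSpace 𝓘(ℝ, E) y) (x : M) {z : E}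
    (hz : z ∈ (extChartAt 𝓘(ℝ, E) x).target) :
    mder (E := E) (E' := E) (extChartAt 𝓘(ℝ, E) x).symm z (fieldInChart V x z) =
      V ((extChartAt 𝓘(ℝ, E) x).symm z) := by
  have h := isInvertible_mfderivWithin_extChartAt_symm (I := 𝓘(ℝ, E)) hz
  have h1 := h.self_apply_inverse (V ((extChartAt 𝓘(ℝ, E) x).symm z))
  rw [show mder (E := E) (E' := E) (extChartAt 𝓘(ℝ, E) x).symm z =
    mfderivWithin 𝓘(ℝ, E) 𝓘(ℝ, E) (extChartAt 𝓘(ℝ, E) x).symm (range 𝓘(ℝ, E)) z by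
      rw [ModelWithCorners.range_eq_univ, mfderivWithin_univ]; rfl]
  exact h1

theorem differentiableAt_fieldInChart [CompleteSpace E] {V : ∀ y : M, TangentSpace 𝓘(ℝ, E) y} {x : M}
    (hV : MDifferentiableAt 𝓘(ℝ, E) 𝓘(ℝ, E).tangent
      (fun y => (⟨y, V y⟩ : TangentBundle 𝓘(ℝ, E) M)) x) :
    DifferentiableAt ℝ (fieldInChart V x) (extChartAt 𝓘(ℝ, E) x x) := by
  have : IsManifold 𝓘(ℝ, E) 2 M := IsManifold.of_le (n := ∞)
    (WithTop.coe_le_coe.2 (le_top : (2 : ℕ∞) ≤ ⊤))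
  rw [← mdifferentiableWithinAt_univ] at hV
  have := hV.differentiableWithinAt_mpullbackWithin_vectorField
  have h : DifferentiableWithinAt ℝ (fieldInChart V x)
      ((extChartAt 𝓘(ℝ, E) x).symm ⁻¹' univ ∩ range 𝓘(ℝ, E)) (extChartAt 𝓘(ℝ, E) x x) := this
  rwa [ModelWithCorners.range_eq_univ, preimage_univ, univ_inter, differentiableWithinAt_univ] at h

theorem mder_extChartAt_mlieBracket (V W : ∀ y : M, TangentSpace 𝓘(ℝ, E) y) (x : M) :
    mder (E := E) (E' := E) (extChartAt 𝓘(ℝ, E) x) x (mlieBracket 𝓘(ℝ, E) V W x) =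
      lieBracket ℝ (fieldInChart V x) (fieldInChart W x) (extChartAt 𝓘(ℝ, E) x x) := by
  have h := isInvertible_mfderiv_extChartAt (I := 𝓘(ℝ, E)) (mem_extChartAt_source x)
  rw [← mlieBracketWithin_univ, mlieBracketWithin_apply]
  have h1 : lieBracketWithin ℝ (fieldInChart V x) (fieldInChart W x)
      ((extChartAt 𝓘(ℝ, E) x).symm ⁻¹' univ ∩ range 𝓘(ℝ, E)) (extChartAt 𝓘(ℝ, E) x x) =
      lieBracket ℝ (fieldInChart V x) (fieldInChart W x) (extChartAt 𝓘(ℝ, E) x x) := by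
    rw [ModelWithCorners.range_eq_univ, preimage_univ, univ_inter, lieBracketWithin_univ]
  exact (h.self_apply_inverse _).trans h1

/-- The brackets of `f`-related vector fields are `f`-related. -/
theorem mder_mlieBracket_of_related [CompleteSpace E] {f : M → M'} {x : M}
    {V W : ∀ y : M, TangentSpace 𝓘(ℝ, E) y} {V' W' : ∀ y : M', TangentSpace 𝓘(ℝ, E') y}
    (hf : ContMDiffAt 𝓘(ℝ, E) 𝓘(ℝ, E') ∞ f x)
    (hV : MDifferentiableAt 𝓘(ℝ, E) 𝓘(ℝ, E).tangent
      (fun y => (⟨y, V y⟩ : TangentBundle 𝓘(ℝ, E) M)) x)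
    (hW : MDifferentiableAt 𝓘(ℝ, E) 𝓘(ℝ, E).tangent
      (fun y => (⟨y, W y⟩ : TangentBundle 𝓘(ℝ, E) M)) x)
    (hV' : MDifferentiableAt 𝓘(ℝ, E') 𝓘(ℝ, E').tangent
      (fun y => (⟨y, V' y⟩ : TangentBundle 𝓘(ℝ, E') M')) (f x))
    (hW' : MDifferentiableAt 𝓘(ℝ, E') 𝓘(ℝ, E').tangent
      (fun y => (⟨y, W' y⟩ : TangentBundle 𝓘(ℝ, E') M')) (f x))
    (hVV' : ∀ y, mder (E := E) (E' := E') f y (V y) = V' (f y))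
    (hWW' : ∀ y, mder (E := E) (E' := E') f y (W y) = W' (f y)) :
    mder (E := E) (E' := E') f x (mlieBracket 𝓘(ℝ, E) V W x) =
      mlieBracket 𝓘(ℝ, E') V' W' (f x) := by
  set φ := extChartAt 𝓘(ℝ, E) x with hφdef
  set ψ := extChartAt 𝓘(ℝ, E') (f x) with hψdef
  let F : E → E' := ψ ∘ f ∘ φ.symm
  have hxs : x ∈ φ.source := mem_extChartAt_source x
  have hxt : φ x ∈ φ.target := mem_extChartAt_target x
  have hφs : ∀ z ∈ φ.target, ContMDiffAt 𝓘(ℝ, E) 𝓘(ℝ, E) ∞ φ.symm z := fun z hz =>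
    (contMDiffOn_extChartAt_symm x).contMDiffAt ((isOpen_extChartAt_target x).mem_nhds hz)
  have hφx : φ.symm (φ x) = x := φ.left_inv hxs
  have hψ : ∀ y ∈ ψ.source, MDifferentiableAt 𝓘(ℝ, E') 𝓘(ℝ, E') ψ y := fun y hy =>
    ((contMDiffOn_extChartAt (n := ∞) (x := f x)).contMDiffAt
      ((chartAt E' (f x)).open_source.mem_nhds
        (by simpa [hψdef] using hy))).mdifferentiableAt (by simp)
  have hF : ContDiffAt ℝ ∞ F (φ x) := by
    rw [← contMDiffAt_iff_contDiffAt]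
    refine ContMDiffAt.comp (I' := 𝓘(ℝ, E')) (M' := M') _ ?_ (ContMDiffAt.comp _ ?_ (hφs _ hxt))
    · rw [Function.comp_apply, hφx]; exact contMDiffAt_extChartAt
    · rwa [hφx]
  have hFx : F (φ x) = ψ (f x) := by simp only [F, Function.comp_apply, hφx]
  have hnear : ∀ᶠ z in 𝓝 (φ x), z ∈ φ.target ∧ f (φ.symm z) ∈ ψ.source ∧
      MDifferentiableAt 𝓘(ℝ, E) 𝓘(ℝ, E') f (φ.symm z) := by
    have hc : ContinuousAt φ.symm (φ x) := (hφs _ hxt).continuousAt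
    have h1 := hc.eventually (p := fun y => f y ∈ ψ.source ∧
      MDifferentiableAt 𝓘(ℝ, E) 𝓘(ℝ, E') f y) (by
        rw [hφx]
        filter_upwards [hf.continuousAt (extChartAt_source_mem_nhds (I := 𝓘(ℝ, E')) (f x)),
          eventually_mdifferentiableAt hf] with y hy hy' using ⟨hy, hy'⟩)
    filter_upwards [(isOpen_extChartAt_target x).mem_nhds hxt, h1] with z hz hz' using ⟨hz, hz'⟩
  have hrel : ∀ (U : ∀ y : M, TangentSpace 𝓘(ℝ, E) y) (U' : ∀ y : M', TangentSpace 𝓘(ℝ, E') y),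
      (∀ y, mder (E := E) (E' := E') f y (U y) = U' (f y)) →
      (fun z => fderiv ℝ F z (fieldInChart U x z)) =ᶠ[𝓝 (φ x)]
        fieldInChart U' (f x) ∘ F := by
    intro U U' hU
    filter_upwards [hnear] with z hz
    have hψz := hψ _ hz.2.1
    have hφz := (hφs z hz.1).mdifferentiableAt (by simp)
    have hzt : F z ∈ ψ.target := ψ.map_source hz.2.1
    have hψF : ψ.symm (F z) = f (φ.symm z) := ψ.left_inv hz.2.1
    have h1 := mder_extChartAt_symm_fieldInChart U x hz.1
    have h2 := mder_extChartAt_symm_fieldInChart U' (f x) hzt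
    have hψs : MDifferentiableAt 𝓘(ℝ, E') 𝓘(ℝ, E') ψ.symm (F z) :=
      ((contMDiffOn_extChartAt_symm (n := ∞) (f x)).contMDiffAt
        ((isOpen_extChartAt_target (f x)).mem_nhds hzt)).mdifferentiableAt (by simp)
    have hinj : (mder (E := E') (E' := E') ψ (f (φ.symm z))).comp
        (mder (E := E') (E' := E') ψ.symm (F z)) = ContinuousLinearMap.id ℝ E' := by
      have h3 := mder_comp (E := E') (E'' := E') (g := ψ) (f := ψ.symm) (x := F z)
        (by rw [hψF]; exact hψz) hψs
      rw [hψF] at h3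
      rw [← h3, mder_congr (f := ψ ∘ ψ.symm) (g := id), mder_id]
      filter_upwards [(isOpen_extChartAt_target (f x)).mem_nhds hzt] with w hw
      exact ψ.right_inv hw
    have h4 : fderiv ℝ F z = (mder (E := E') (E' := E') ψ (f (φ.symm z))).comp
        ((mder (E := E) (E' := E') f (φ.symm z)).comp
          (mder (E := E) (E' := E) φ.symm z)) := by
      rw [← mder_comp hz.2.2 hφz, ← mder_eq_fderiv]
      exact mder_comp (g := ψ) (f := f ∘ φ.symm) hψz (hz.2.2.comp z hφz)
    rw [h4, ContinuousLinearMap.comp_apply, ContinuousLinearMap.comp_apply, h1, hU]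
    have h5 : (U' (f (φ.symm z)) : E') = U' (ψ.symm (F z)) := by rw [hψF]
    refine (congrArg _ (h5.trans h2.symm)).trans ?_
    exact DFunLike.congr_fun hinj _
  have hdV := differentiableAt_fieldInChart hV
  have hdW := differentiableAt_fieldInChart hW
  have hdV' := differentiableAt_fieldInChart hV'
  have hdW' := differentiableAt_fieldInChart hW'
  have hFd : DifferentiableAt ℝ F (φ x) := hF.differentiableAt (by simp)
  -- By symmetry of the second derivative, `DF [V, W]` is the difference of the derivatives of
  -- `DF·W` along `V` and of `DF·V` along `W`. Relatedness near the point replaces these fields by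
  -- `W' ∘ F` and `V' ∘ F`.
  have key : fderiv ℝ F (φ x) (lieBracket ℝ (fieldInChart V x) (fieldInChart W x) (φ x)) =
      lieBracket ℝ (fieldInChart V' (f x)) (fieldInChart W' (f x)) (ψ (f x)) := by
    rw [fderiv_apply_lieBracket (n := ∞) hF
      (by simp [minSmoothness_of_isRCLikeNormedField]
          exact WithTop.coe_le_coe.2 (le_top : (2 : ℕ∞) ≤ ⊤)) hdW hdV,
      (hrel W W' hWW').fderiv_eq, (hrel V V' hVV').fderiv_eq,
      fderiv_comp (φ x) (by rw [hFx]; exact hdW') hFd,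
      fderiv_comp (φ x) (by rw [hFx]; exact hdV') hFd,
      ContinuousLinearMap.comp_apply, ContinuousLinearMap.comp_apply]
    have eV : fderiv ℝ F (φ x) (fieldInChart V x (φ x)) = fieldInChart V' (f x) (F (φ x)) :=
      (hrel V V' hVV').self_of_nhds
    have eW : fderiv ℝ F (φ x) (fieldInChart W x (φ x)) = fieldInChart W' (f x) (F (φ x)) :=
      (hrel W W' hWW').self_of_nhds
    rw [eV, eW, hFx, lieBracket]
  rw [← mder_extChartAt_mlieBracket, ← mder_extChartAt_mlieBracket] at key
  have hF' : (fderiv ℝ F (φ x)).comp (mder (E := E) (E' := E) φ x) =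
      (mder (E := E') (E' := E') ψ (f x)).comp (mder (E := E) (E' := E') f x) := by
    have hfx := hf.mdifferentiableAt (n := ∞) (by simp)
    rw [← mder_comp (hψ _ (mem_extChartAt_source _)) hfx, ← mder_eq_fderiv,
      ← mder_comp hFd.mdifferentiableAt
        ((contMDiffAt_extChartAt (n := ∞)).mdifferentiableAt (by simp))]
    apply mder_congr
    filter_upwards [extChartAt_source_mem_nhds (I := 𝓘(ℝ, E)) x] with y hy
    simp only [F, Function.comp_apply]
    rw [φ.left_inv hy]
  have h6 := DFunLike.congr_fun hF' (mlieBracket 𝓘(ℝ, E) V W x)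
  have hψinj : Function.Injective (mder (E := E') (E' := E') ψ (f x)) :=
    (isInvertible_mfderiv_extChartAt (I := 𝓘(ℝ, E')) (mem_extChartAt_source (f x))).injective
  exact hψinj (h6.symm.trans key)

end LieBracket

/-! ### Homomorphisms of Lie groups and their Lie algebras. -/

section LieGroups

open VectorField

variable {F : Type*} [NormedAddCommGroup F] [NormedSpace ℝ F] [CompleteSpace F]
  {G : Type*} [TopologicalSpace G] [ChartedSpace F G] [Group G] [LieGroup 𝓘(ℝ, F) ∞ G]
  {F' : Type*} [NormedAddCommGroup F'] [NormedSpace ℝ F'] [CompleteSpace F']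
  {G' : Type*} [TopologicalSpace G'] [ChartedSpace F' G'] [Group G'] [LieGroup 𝓘(ℝ, F') ∞ G']

/-- The derivative of a smooth group homomorphism preserves Lie brackets. -/
theorem mder_bracket_of_hom (q : G →* G') (hq : ContMDiff 𝓘(ℝ, F) 𝓘(ℝ, F') ∞ q)
    {ξ η : GroupLieAlgebra 𝓘(ℝ, F) G} {ξ' η' : GroupLieAlgebra 𝓘(ℝ, F') G'}
    (hξ : mder (E := F) (E' := F') q 1 ξ = ξ') (hη : mder (E := F) (E' := F') q 1 η = η') :
    mder (E := F) (E' := F') q 1 (⁅ξ, η⁆ : GroupLieAlgebra 𝓘(ℝ, F) G) =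
      (⁅ξ', η'⁆ : GroupLieAlgebra 𝓘(ℝ, F') G') := by
  have h3 : minSmoothness ℝ 3 ≤ ∞ := by
    rw [minSmoothness_of_isRCLikeNormedField]
    exact WithTop.coe_le_coe.2 (le_top : (3 : ℕ∞) ≤ ⊤)
  have : LieGroup 𝓘(ℝ, F) (minSmoothness ℝ 3) G := LieGroup.of_le h3
  have : LieGroup 𝓘(ℝ, F') (minSmoothness ℝ 3) G' := LieGroup.of_le h3
  have : IsManifold 𝓘(ℝ, F) ∞ G := inferInstance
  -- Invariant fields are `q`-related: differentiate `q ∘ L_g = L_{q g} ∘ q` at `1`.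
  have hrel : ∀ (ζ : GroupLieAlgebra 𝓘(ℝ, F) G) (ζ' : GroupLieAlgebra 𝓘(ℝ, F') G'),
      mder (E := F) (E' := F') q 1 ζ = ζ' → ∀ g : G,
      mder (E := F) (E' := F') q g (mulInvariantVectorField ζ g) =
      mulInvariantVectorField ζ' (q g) := by
    rintro ζ ζ' rfl g
    have hL : ∀ h : G, MDifferentiableAt 𝓘(ℝ, F) 𝓘(ℝ, F) (g * ·) h := fun h =>
      (contMDiff_mul_left (I := 𝓘(ℝ, F)) (n := ∞) (a := g)).mdifferentiable (by simp) h
    have hL' : ∀ h : G', MDifferentiableAt 𝓘(ℝ, F') 𝓘(ℝ, F') (q g * ·) h := fun h =>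
      (contMDiff_mul_left (I := 𝓘(ℝ, F')) (n := ∞) (a := q g)).mdifferentiable (by simp) h
    have hqd : MDifferentiable 𝓘(ℝ, F) 𝓘(ℝ, F') q := hq.mdifferentiable (by simp)
    have h1 : q ∘ (g * ·) = (q g * ·) ∘ q := by ext h; simp
    have h2 : mder (E := F) (E' := F') (q ∘ (g * ·)) 1 =
        mder (E := F) (E' := F') ((q g * ·) ∘ q) 1 := by rw [h1]
    rw [mder_comp (hqd _) (hL 1), mder_comp (hL' _) (hqd 1), mul_one, map_one] at h2
    exact DFunLike.congr_fun h2 ζ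
  have hmd := fun (ζ : GroupLieAlgebra 𝓘(ℝ, F) G) =>
    mdifferentiableAt_mulInvariantVectorField ζ (g := (1 : G))
  have hmd' := fun (ζ : GroupLieAlgebra 𝓘(ℝ, F') G') =>
    mdifferentiableAt_mulInvariantVectorField ζ (g := q 1)
  have key := mder_mlieBracket_of_related (hq 1) (hmd ξ) (hmd η) (hmd' _) (hmd' _) (hrel ξ ξ' hξ)
    (hrel η η' hη)
  rw [GroupLieAlgebra.bracket_def, GroupLieAlgebra.bracket_def]
  rw [map_one] at key
  exact key

end LieGroups

/-! ### The double orthogonal for a degenerate 2-form. -/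

section LinearAlgebra

variable {V : Type*} [NormedAddCommGroup V] [NormedSpace ℝ V]

theorem twoForm_add_left (α : V [⋀^Fin 2]→L[ℝ] ℝ) (a b w : V) :
    α ![a + b, w] = α ![a, w] + α ![b, w] :=
  α.toMultilinearMap.cons_add ![w] a b

theorem twoForm_smul_left (α : V [⋀^Fin 2]→L[ℝ] ℝ) (c : ℝ) (a w : V) :
    α ![c • a, w] = c * α ![a, w] :=
  α.toMultilinearMap.cons_smul ![w] c a

theorem twoForm_swap (α : V [⋀^Fin 2]→L[ℝ] ℝ) (v w : V) : α ![v, w] = -α ![w, v] := by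
  have h := α.toAlternatingMap.map_swap ![w, v] (i := 0) (j := 1) (by decide)
  have h' : ![w, v] ∘ Equiv.swap (0 : Fin 2) 1 = ![v, w] := by
    ext i; fin_cases i <;> simp
  rw [h'] at h
  exact h

/-- A 2-form as a bilinear map. -/
def twoFormBilin (α : V [⋀^Fin 2]→L[ℝ] ℝ) : V →ₗ[ℝ] Module.Dual ℝ V :=
  LinearMap.mk₂ ℝ (fun v w => α ![v, w]) (twoForm_add_left α) (twoForm_smul_left α)
    (fun v w w' => by
      rw [twoForm_swap α v, twoForm_add_left, neg_add, ← twoForm_swap, ← twoForm_swap])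
    (fun c v w => by
      rw [twoForm_swap α v, twoForm_smul_left, twoForm_swap α w]; simp)

/-- If `v` is `α`-orthogonal to the `α`-orthogonal of the range of `T`, it lies in the range of `T`
up to an element of `ker α`. -/
theorem exists_eq_of_mem_orthogonal_orthogonal {W : Type*} [AddCommGroup W] [Module ℝ W]
    [FiniteDimensional ℝ W] (α : V [⋀^Fin 2]→L[ℝ] ℝ) (T : W →ₗ[ℝ] V) (v : V)
    (hv : ∀ w, (∀ ξ, α ![T ξ, w] = 0) → α ![v, w] = 0) :
    ∃ ξ, ∀ w, α ![v - T ξ, w] = 0 := by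
  -- A finite-dimensional subspace of the dual is the annihilator of its coannihilator, here the
  -- `α`-orthogonal of the range of `T`. Only `W` has to be finite-dimensional.
  have h1 : twoFormBilin α v ∈ LinearMap.range (twoFormBilin α ∘ₗ T) := by
    rw [← Subspace.dualCoannihilator_dualAnnihilator_eq
      (W := LinearMap.range (twoFormBilin α ∘ₗ T)), Submodule.mem_dualAnnihilator]
    intro w hw
    rw [Submodule.mem_dualCoannihilator] at hw
    exact hv w fun ξ => hw _ ⟨ξ, rfl⟩
  obtain ⟨ξ, hξ⟩ := h1
  refine ⟨ξ, fun w => ?_⟩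
  have h2 : twoFormBilin α (v - T ξ) w = 0 := by
    rw [map_sub, ← hξ, LinearMap.comp_apply, sub_self, LinearMap.zero_apply]
  exact h2

end LinearAlgebra

/-! ### The kernel of the form induced on a level set. -/

section Isotropy

variable {F : Type*} [NormedAddCommGroup F] [NormedSpace ℝ F] [FiniteDimensional ℝ F]
  {G : Type*} [TopologicalSpace G] [ChartedSpace F G] [Group G]
  {E : Type*} [NormedAddCommGroup E] [NormedSpace ℝ E]
  {M : Type*} [TopologicalSpace M] [ChartedSpace E M] [MulAction G M]
  {S : Type*} [NormedAddCommGroup S] [NormedSpace ℝ S]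

/-- The kernel of the form induced on a level set of a momentum map consists of the isotropy
directions, as soon as the kernel of the ambient form consists of fundamental directions. -/
theorem kerIsIsotropyDirections_of_momentumMap {Ω : TwoForm E M}
    {J : M → Module.Dual ℝ (GroupLieAlgebra 𝓘(ℝ, F) G)}
    {μ : Module.Dual ℝ (GroupLieAlgebra 𝓘(ℝ, F) G)} [ChartedSpace S (LevelSet J μ)]
    (hreg : IsWeaklyRegularValue (E := E) (E' := S) J μ)
    (hham : ∀ (ξ : F) (x : M) (v : E),
      Ω.val x ![mder (E := F) (E' := E) (fun g : G => g • x) 1 ξ, v] =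
        mder (E := E) (E' := ℝ) (fun y => J y ξ) x v)
    (hpois : ∀ (ξ η : GroupLieAlgebra 𝓘(ℝ, F) G) (x : M), J x ⁅ξ, η⁆ =
      Ω.val x ![mder (E := F) (E' := E) (fun g : G => g • x) 1 ξ,
        mder (E := F) (E' := E) (fun g : G => g • x) 1 η])
    (hker : ∀ (x : M) (v : E), v ∈ Ω.kerAt x →
      ∃ ξ : F, mder (E := F) (E' := E) (fun g : G => g • x) 1 ξ = v) :
    KerIsIsotropyDirections S Ω J μ := by
  intro x
  let T : F →L[ℝ] E := mder (E := F) (E' := E) (fun g : G => g • (x : M)) 1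
  let i : S →L[ℝ] E := mder (E := S) (E' := E) (Subtype.val : LevelSet J μ → M) x
  -- The tangent space of the level set is the `Ω`-orthogonal of the orbit directions.
  have htan : ∀ v : E, (∃ u, i u = v) ↔ ∀ ξ : F, Ω.val x ![T ξ, v] = 0 := fun v =>
    (hreg.tangent x v).trans (forall_congr' fun ξ => by rw [hham ξ x v]; rfl)
  have hkerN : ∀ u : S, u ∈ (levelForm S Ω J μ).kerAt x ↔ ∀ w : S, Ω.val x ![i u, i w] = 0 :=
    fun u => forall_congr' fun (w : S) =>
      iff_of_eq (congrArg (· = 0) (compContinuousLinearMap_apply_two (Ω.val x) i u w))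
  suffices h : ∀ v : E, (∃ u : S, u ∈ (levelForm S Ω J μ).kerAt x ∧ i u = v) ↔
      ∃ ξ : F, (∀ η : F, Ω.val x ![T ξ, T η] = 0) ∧ T ξ = v by
    intro v
    refine (h v).trans (exists_congr fun ξ => and_congr_left fun _ => forall_congr' fun η => ?_)
    rw [← hpois ξ η x, x.2]
  intro v
  constructor
  · rintro ⟨u, hu, rfl⟩
    rw [hkerN] at hu
    obtain ⟨ξ, hξ⟩ := exists_eq_of_mem_orthogonal_orthogonal (Ω.val x) (T : F →ₗ[ℝ] E) (i u)
      fun w hw => by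
        obtain ⟨w', rfl⟩ := (htan w).2 hw
        exact hu w'
    -- The double orthogonal gives `i u = T ξ` only modulo `ker Ω`; `ζ` absorbs the difference.
    obtain ⟨ζ, hζ⟩ := hker x _ hξ
    have hsum : T (ξ + ζ) = i u := by
      rw [map_add]
      exact (congrArg (T ξ + ·) hζ).trans (add_sub_cancel _ _)
    refine ⟨ξ + ζ, fun η => ?_, hsum⟩
    rw [hsum, twoForm_swap, (htan (i u)).1 ⟨u, rfl⟩ η, neg_zero]
  · rintro ⟨ξ, hξ, rfl⟩
    obtain ⟨u, hu⟩ := (htan (T ξ)).2 fun η => by rw [twoForm_swap, hξ, neg_zero]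
    refine ⟨u, (hkerN u).2 fun w => ?_, hu⟩
    rw [hu]
    exact (htan (i w)).1 ⟨w, rfl⟩ ξ

end Isotropy

/-! ### From vector fields in `ker Ω` to single vectors. -/

section Gauge

universe u

variable {F : Type*} [NormedAddCommGroup F] [NormedSpace ℝ F]
  {G : Type*} [TopologicalSpace G] [ChartedSpace F G] [Group G]
  {E : Type u} [NormedAddCommGroup E] [NormedSpace ℝ E] [FiniteDimensional ℝ E]
  {M : Type*} [TopologicalSpace M] [ChartedSpace E M] [MulAction G M] [T2Space M]
  [IsManifold 𝓘(ℝ, E) ∞ M]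
  {E₁ : Type*} [NormedAddCommGroup E₁] [NormedSpace ℝ E₁]

/-- If the vector fields in `ker Ω` are generated by fundamental fields, the vectors in `ker Ω` are
values of fundamental fields. -/
theorem KerGeneratedBy.exists_fundamental {𝔥 : Submodule ℝ (GroupLieAlgebra 𝓘(ℝ, F) G)}
    {Ω : TwoForm E M} (hker : KerGeneratedBy 𝔥 Ω)
    [ChartedSpace E₁ (LeafSpace Ω)] [IsManifold 𝓘(ℝ, E₁) ∞ (LeafSpace Ω)]
    (hq : IsLeafQuotient (E' := E₁) Ω) (x : M) (v : E) (hv : v ∈ Ω.kerAt x) :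
    ∃ ξ : F, mder (E := F) (E' := E) (fun g : G => g • x) 1 ξ = v := by
  obtain ⟨Z, hZ, rfl, hZk⟩ := exists_vertical_vectorField hq.submersion x v
    ((hq.ker_mfderiv x v).2 hv)
  obtain ⟨n, f, ξ, -, -, h⟩ := hker Z hZ fun y => (hq.ker_mfderiv y (Z y)).1 (hZk y)
  let ξ' : Fin n → F := ξ
  -- The coefficient functions are frozen at `x`, which gives one Lie algebra element.
  refine ⟨∑ i, f i x • ξ' i, ?_⟩
  refine (map_sum _ _ _).trans (Eq.trans ?_ (h x).symm)
  exact Finset.sum_congr rfl fun i _ => map_smul _ (f i x) (ξ' i)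

end Gauge

/-! ### Fundamental fields of equivariantly related actions. -/

section Equivariance

variable {F : Type*} [NormedAddCommGroup F] [NormedSpace ℝ F]
  {G : Type*} [TopologicalSpace G] [ChartedSpace F G] [Group G]
  {F' : Type*} [NormedAddCommGroup F'] [NormedSpace ℝ F']
  {G' : Type*} [TopologicalSpace G'] [ChartedSpace F' G'] [Group G']
  {E : Type*} [NormedAddCommGroup E] [NormedSpace ℝ E]
  {M : Type*} [TopologicalSpace M] [ChartedSpace E M] [MulAction G M]
  {E' : Type*} [NormedAddCommGroup E'] [NormedSpace ℝ E']
  {M' : Type*} [TopologicalSpace M'] [ChartedSpace E' M'] [MulAction G' M']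

theorem contMDiff_smul_left [ContMDiffSMul 𝓘(ℝ, F) 𝓘(ℝ, E) ∞ G M] (x : M) :
    ContMDiff 𝓘(ℝ, F) 𝓘(ℝ, E) ∞ (fun g : G => g • x) :=
  contMDiff_id.smul contMDiff_const

/-- The action of `G'` is not assumed smooth. Its orbit maps through points `π x` are smooth because
they become smooth after composition with `q`, which has local sections. -/
theorem contMDiffAt_orbit_of_equivariant [ContMDiffSMul 𝓘(ℝ, F) 𝓘(ℝ, E) ∞ G M] {q : G →* G'}
    (hq : HasLocalSections F F' q) {π : M → M'} (hπ : ContMDiff 𝓘(ℝ, E) 𝓘(ℝ, E') ∞ π)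
    (hact : ∀ (g : G) (x : M), q g • π x = π (g • x)) (x : M) :
    ContMDiffAt 𝓘(ℝ, F') 𝓘(ℝ, E') ∞ (fun g : G' => g • π x) 1 := by
  rw [← map_one q]
  refine hq.contMDiffAt_of_comp (x := (1 : G)) ?_
  have : (fun g : G' => g • π x) ∘ q = π ∘ fun g : G => g • x := funext fun g => hact g x
  rw [this]
  exact (hπ.comp (contMDiff_smul_left x)) 1

/-- Fundamental fields of equivariantly related actions are related. -/
theorem mder_orbit_of_equivariant [ContMDiffSMul 𝓘(ℝ, F) 𝓘(ℝ, E) ∞ G M] {q : G →* G'}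
    (hq : HasLocalSections F F' q) (hqs : ContMDiff 𝓘(ℝ, F) 𝓘(ℝ, F') ∞ q)
    {π : M → M'} (hπ : ContMDiff 𝓘(ℝ, E) 𝓘(ℝ, E') ∞ π)
    (hact : ∀ (g : G) (x : M), q g • π x = π (g • x)) (x : M) (ξ : F) :
    mder (E := F') (E' := E') (fun g : G' => g • π x) 1 (mder (E := F) (E' := F') q 1 ξ) =
      mder (E := E) (E' := E') π x (mder (E := F) (E' := E) (fun g : G => g • x) 1 ξ) := by
  have h1 : (fun g : G' => g • π x) ∘ q = π ∘ fun g : G => g • x := funext fun g => hact g x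
  have h2 : mder (E := F) (E' := E') ((fun g : G' => g • π x) ∘ q) 1 =
    mder (E := F) (E' := E') (π ∘ fun g : G => g • x) 1 := by rw [h1]
  have h3 : MDifferentiableAt 𝓘(ℝ, F') 𝓘(ℝ, E') (fun g : G' => g • π x) (q 1) := by
    rw [map_one]
    exact (contMDiffAt_orbit_of_equivariant hq hπ hact x).mdifferentiableAt (by simp)
  rw [mder_comp h3 (hqs.mdifferentiable (by simp) 1),
    mder_comp (hπ.mdifferentiable (by simp) _)
      ((contMDiff_smul_left x).mdifferentiable (by simp) 1), map_one, one_smul] at h2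
  exact DFunLike.congr_fun h2 ξ

/-- An invariant function is annihilated by the fundamental fields. -/
theorem mder_invariant_orbit {H : M' → ℝ} (hH : ContMDiff 𝓘(ℝ, E') 𝓘(ℝ, ℝ) ∞ H) {y : M'}
    (hinv : ∀ g : G', H (g • y) = H y)
    (hy : ContMDiffAt 𝓘(ℝ, F') 𝓘(ℝ, E') ∞ (fun g : G' => g • y) 1) (ξ : F') :
    mder (E := E') (E' := ℝ) H y (mder (E := F') (E' := E') (fun g : G' => g • y) 1 ξ) = 0 := by
  have h1 : mder (E := F') (E' := ℝ) (H ∘ fun g : G' => g • y) 1 = 0 := by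
    rw [show (H ∘ fun g : G' => g • y) = fun _ => H y from funext hinv, mder_const]
  rw [mder_comp (hH.mdifferentiable (by simp) _) (hy.mdifferentiableAt (by simp)),
    one_smul] at h1
  exact DFunLike.congr_fun h1 ξ

end Equivariance

/-! ### Restriction of maps, sections and leaves to embedded level sets. -/

section Restriction

variable {E : Type*} [NormedAddCommGroup E] [NormedSpace ℝ E]
  {M : Type*} [TopologicalSpace M] [ChartedSpace E M]
  {E' : Type*} [NormedAddCommGroup E'] [NormedSpace ℝ E']
  {M' : Type*} [TopologicalSpace M'] [ChartedSpace E' M']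
  {S : Type*} [NormedAddCommGroup S] [NormedSpace ℝ S]
  {S' : Type*} [NormedAddCommGroup S'] [NormedSpace ℝ S']
  {P : M → Prop} [ChartedSpace S {x // P x}]
  {P' : M' → Prop} [ChartedSpace S' {x // P' x}]

/-- The topological embedding gives continuity of `f`, and the immersion then gives smoothness. -/
theorem contMDiffAt_of_val_comp [IsManifold 𝓘(ℝ, S) ∞ {x // P x}]
    (hP : Manifold.IsSmoothEmbedding 𝓘(ℝ, S) 𝓘(ℝ, E) ∞ (Subtype.val : {x // P x} → M))
    {f : M' → {x // P x}} {y : M'}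
    (hf : ContMDiffAt 𝓘(ℝ, E') 𝓘(ℝ, E) ∞ (Subtype.val ∘ f) y) :
    ContMDiffAt 𝓘(ℝ, E') 𝓘(ℝ, S) ∞ f y :=
  (ContMDiffAt.iff_comp_isImmersionAt (hP.isImmersion.isImmersionAt (f y))).2
    ⟨hP.isEmbedding.continuousAt_iff.2 hf.continuousAt, hf⟩

theorem contMDiff_subtypeMap [IsManifold 𝓘(ℝ, S') ∞ {x // P' x}]
    (hP : Manifold.IsSmoothEmbedding 𝓘(ℝ, S) 𝓘(ℝ, E) ∞ (Subtype.val : {x // P x} → M))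
    (hP' : Manifold.IsSmoothEmbedding 𝓘(ℝ, S') 𝓘(ℝ, E') ∞ (Subtype.val : {x // P' x} → M'))
    {π : M → M'} (hπ : ContMDiff 𝓘(ℝ, E) 𝓘(ℝ, E') ∞ π) (h : ∀ x, P x → P' (π x)) :
    ContMDiff 𝓘(ℝ, S) 𝓘(ℝ, S') ∞ (Subtype.map π h) := fun x =>
  contMDiffAt_of_val_comp hP' ((hπ.comp hP.contMDiff) x)

theorem hasLocalSections_subtypeMap [IsManifold 𝓘(ℝ, S) ∞ {x // P x}]
    (hP : Manifold.IsSmoothEmbedding 𝓘(ℝ, S) 𝓘(ℝ, E) ∞ (Subtype.val : {x // P x} → M))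
    (hP' : Manifold.IsSmoothEmbedding 𝓘(ℝ, S') 𝓘(ℝ, E') ∞ (Subtype.val : {x // P' x} → M'))
    {π : M → M'} (hπ : HasLocalSections E E' π) (h : ∀ x, P x ↔ P' (π x)) :
    HasLocalSections S S' (Subtype.map π fun x => (h x).1) := by
  classical
  intro x
  obtain ⟨s, hs, hsx, he⟩ := hπ (x : M)
  -- `P` is the preimage of `P'`, so a local section automatically lands in it near the base point.
  -- The value `x` elsewhere is arbitrary.
  let s' : {y // P' y} → {x // P x} := fun y => if hy : P (s y) then ⟨s y, hy⟩ else x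
  let y₀ : {y // P' y} := Subtype.map π (fun x => (h x).1) x
  have hval : ∀ᶠ y : {y // P' y} in 𝓝 y₀, P (s y) ∧ π (s y) = y := by
    have hc : ContinuousAt (Subtype.val : {y // P' y} → M') y₀ := continuous_subtype_val.continuousAt
    filter_upwards [hc.eventually he] with y hy
    exact ⟨(h _).2 (by rw [hy]; exact y.2), hy⟩
  have hs' : ∀ y : {y // P' y}, P (s y) → (s' y : M) = s y := fun y hy => by simp only [s', dif_pos hy]
  refine ⟨s', ?_, ?_, ?_⟩
  · apply contMDiffAt_of_val_comp hP
    have h1 : ContMDiffAt 𝓘(ℝ, S') 𝓘(ℝ, E) ∞ (s ∘ Subtype.val) y₀ :=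
      ContMDiffAt.comp y₀ (by exact hs) hP'.contMDiff.contMDiffAt
    refine h1.congr_of_eventuallyEq ?_
    filter_upwards [hval] with y hy using hs' y hy.1
  · apply Subtype.ext
    rw [hs' _ (by change P (s (π x)); rw [hsx]; exact x.2)]
    exact hsx
  · filter_upwards [hval] with y hy
    apply Subtype.ext
    change π (s' y) = y
    rw [hs' y hy.1, hy.2]

/-- Points of a saturated submanifold in the same leaf of `ker Ω` are in the same leaf of the
kernel of the induced form. -/
theorem leafProj_pullback_eq [IsManifold 𝓘(ℝ, S) ∞ {x // P x}] {Ω : TwoForm E M}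
    [ChartedSpace E' (LeafSpace Ω)] [IsManifold 𝓘(ℝ, E') ∞ (LeafSpace Ω)] (hq : IsLeafQuotient (E' := E') Ω)
    (hP : Manifold.IsSmoothEmbedding 𝓘(ℝ, S) 𝓘(ℝ, E) ∞ (Subtype.val : {x // P x} → M))
    (hsat : ∀ a b, leafProj Ω a = leafProj Ω b → P a → P b) (p r : {x // P x})
    (h : leafProj Ω (p : M) = leafProj Ω (r : M)) :
    leafProj (TwoForm.pullback (E := S) (Subtype.val : {x // P x} → M) Ω) p =
      leafProj (TwoForm.pullback (E := S) (Subtype.val : {x // P x} → M) Ω) r := by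
  have hπd : MDifferentiable 𝓘(ℝ, E) 𝓘(ℝ, E') (leafProj Ω) :=
    hq.submersion.contMDiff.mdifferentiable (by simp)
  suffices H : ∀ a b : M, Relation.EqvGen (KerJoined Ω) a b → ∀ (ha : P a) (hb : P b),
      leafProj (TwoForm.pullback (E := S) (Subtype.val : {x // P x} → M) Ω) ⟨a, ha⟩ =
      leafProj (TwoForm.pullback (E := S) (Subtype.val : {x // P x} → M) Ω) ⟨b, hb⟩ from
    H p r (Quotient.exact h) p.2 r.2
  intro a b hab
  induction hab with
  | refl => intro _ _; rfl
  | symm _ _ _ ih => intro ha hb; exact (ih hb ha).symm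
  | trans a b c h1 h2 ih1 ih2 =>
    intro ha hc
    have hb : P b := hsat a b (Quotient.sound h1) ha
    exact (ih1 ha hb).trans (ih2 hb hc)
  | rel a b h =>
    intro ha hb
    obtain ⟨γ, hγ, rfl, rfl, hk⟩ := h
    have hγd : MDifferentiable 𝓘(ℝ, ℝ) 𝓘(ℝ, E) γ := hγ.mdifferentiable (by simp)
    have hconst : ∀ s t, leafProj Ω (γ s) = leafProj Ω (γ t) :=
      eq_of_mder_eq_zero (A := E') (c := leafProj Ω ∘ γ) (hπd.comp hγd) fun t => by
        rw [mder_comp (hπd _) (hγd t)]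
        exact (hq.ker_mfderiv _ _).2 (hk t)
    -- A curve tangent to `ker Ω` stays in one leaf, hence in the saturated set. Its velocity,
    -- orthogonal to all of `TM`, is in particular orthogonal to the submanifold.
    let δ : ℝ → {x // P x} := fun t => ⟨γ t, hsat _ _ (hconst 0 t) ha⟩
    have hδ : ContMDiff 𝓘(ℝ, ℝ) 𝓘(ℝ, S) ∞ δ := fun t => contMDiffAt_of_val_comp hP (hγ t)
    refine Quotient.sound (Relation.EqvGen.rel _ _ ⟨δ, hδ, rfl, rfl, fun t => ?_⟩)
    change (mder (E := ℝ) (E' := S) δ t 1) ∈ _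
    rw [TwoForm.mem_kerAt_iff]
    intro w
    have h1 : mder (E := S) (E' := E) (Subtype.val : {x // P x} → M) (δ t)
        (mder (E := ℝ) (E' := S) δ t 1) = mder (E := ℝ) (E' := E) γ t 1 := by
      have h2 := mder_comp (E := ℝ) (E' := S) (E'' := E) (g := (Subtype.val : {x // P x} → M))
        (f := δ) (x := t) (hP.contMDiff.mdifferentiable (by simp) _)
        (hδ.mdifferentiable (by simp) t)
      exact (DFunLike.congr_fun h2 (1 : ℝ)).symm
    rw [TwoForm.val_pullback, compContinuousLinearMap_apply_two, h1]
    exact hk t _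

end Restriction

theorem leafProj_surjective {E : Type*} [NormedAddCommGroup E] [NormedSpace ℝ E]
    {N : Type*} [TopologicalSpace N] [ChartedSpace E N] (α : TwoForm E N) :
    Function.Surjective (leafProj α) :=
  Quotient.exists_rep

/-! ### Maps and diffeomorphisms between leaf spaces. -/

section LeafSpaces

variable {E : Type*} [NormedAddCommGroup E] [NormedSpace ℝ E]
  {N : Type*} [TopologicalSpace N] [ChartedSpace E N] [IsManifold 𝓘(ℝ, E) ∞ N]
  {Q : Type*} [NormedAddCommGroup Q] [NormedSpace ℝ Q]
  {α : TwoForm E N} [ChartedSpace Q (LeafSpace α)] [IsManifold 𝓘(ℝ, Q) ∞ (LeafSpace α)]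
  {E' : Type*} [NormedAddCommGroup E'] [NormedSpace ℝ E']
  {N' : Type*} [TopologicalSpace N'] [ChartedSpace E' N'] [IsManifold 𝓘(ℝ, E') ∞ N']
  {Q' : Type*} [NormedAddCommGroup Q'] [NormedSpace ℝ Q']
  {β : TwoForm E' N'} [ChartedSpace Q' (LeafSpace β)] [IsManifold 𝓘(ℝ, Q') ∞ (LeafSpace β)]

/-- A smooth map annihilating `ker α` descends to a smooth map on the space of leaves. -/
theorem IsLeafQuotient.exists_lift (hα : IsLeafQuotient (E' := Q) α) {f : N → N'} (hf : ContMDiff 𝓘(ℝ, E) 𝓘(ℝ, E') ∞ f)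
    (h0 : ∀ (x : N) (v : E), v ∈ α.kerAt x → mder (E := E) (E' := E') f x v = 0) :
    ∃ g : LeafSpace α → N', ContMDiff 𝓘(ℝ, Q) 𝓘(ℝ, E') ∞ g ∧ g ∘ leafProj α = f := by
  have h1 : ∀ p q, leafProj α p = leafProj α q → f p = f q := fun p q =>
    eq_of_leafProj_eq (hf.mdifferentiable (by simp)) h0
  let g : LeafSpace α → N' := Quotient.lift f fun p q h => h1 p q (Quotient.sound h)
  have hg : g ∘ leafProj α = f := rfl
  exact ⟨g, (hasLocalSections_of_isSubmersion hα.submersion).contMDiff_of_comp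
    (leafProj_surjective α) (hg ▸ hf), hg⟩

/-- Spaces of leaves related by a submersion with fibres in the leaves are diffeomorphic. -/
theorem IsLeafQuotient.exists_diffeomorph (hα : IsLeafQuotient (E' := Q) α)
    (hβ : IsLeafQuotient (E' := Q') β) {π : N → N'} (hπ : ContMDiff 𝓘(ℝ, E) 𝓘(ℝ, E') ∞ π)
    (hls : HasLocalSections E E' π) (hsurj : Function.Surjective π)
    (hpb : TwoForm.pullback π β = α)
    (hfib : ∀ p r, π p = π r → leafProj α p = leafProj α r) :
    ∃ ρ : LeafSpace α ≃ₘ^∞⟮𝓘(ℝ, Q), 𝓘(ℝ, Q')⟯ LeafSpace β,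
      ρ ∘ leafProj α = leafProj β ∘ π := by
  have hker : ∀ (x : N) (v : E), v ∈ α.kerAt x ↔ mder (E := E) (E' := E') π x v ∈ β.kerAt (π x) := by
    intro x v
    have h1 : α.val x = _ := congrArg (fun α : TwoForm E N => α.val x) hpb.symm
    rw [TwoForm.mem_kerAt_iff, TwoForm.mem_kerAt_iff, h1, TwoForm.val_pullback]
    simp only [compContinuousLinearMap_apply_two]
    exact (hls.mder_surjective hπ x).forall (p := fun w => β.val (π x) ![_, w] = 0) |>.symm
  have hαs : ContMDiff 𝓘(ℝ, E) 𝓘(ℝ, Q) ∞ (leafProj α) := hα.submersion.contMDiff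
  have hβs : ContMDiff 𝓘(ℝ, E') 𝓘(ℝ, Q') ∞ (leafProj β) := hβ.submersion.contMDiff
  obtain ⟨f, hf, hfe⟩ := hα.exists_lift (hβs.comp hπ) fun x v hv => by
    rw [mder_comp (hβs.mdifferentiable (by simp) _) (hπ.mdifferentiable (by simp) _)]
    exact (hβ.ker_mfderiv _ _).2 ((hker x v).1 hv)
  choose s hs using hsurj
  -- The inverse is induced by an arbitrary set-theoretic section `s`. Constancy on fibres gives `k
  -- ∘ π = leafProj α`, and smoothness of `k` follows by descent.
  let k : N' → LeafSpace α := fun y => leafProj α (s y)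
  have hkπ : k ∘ π = leafProj α := funext fun x => hfib _ _ (hs (π x))
  have hk : ContMDiff 𝓘(ℝ, E') 𝓘(ℝ, Q) ∞ k :=
    hls.contMDiff_of_comp (fun y => ⟨s y, hs y⟩) (hkπ ▸ hαs)
  obtain ⟨g, hg, hge⟩ := hβ.exists_lift hk fun y w hw => by
    obtain ⟨x, rfl⟩ : ∃ x, π x = y := ⟨s y, hs y⟩
    obtain ⟨v, rfl⟩ := hls.mder_surjective hπ x w
    have h2 := mder_comp (g := k) (f := π) (x := x) (hk.mdifferentiable (by simp) _)
      (hπ.mdifferentiable (by simp) _)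
    rw [hkπ] at h2
    exact (DFunLike.congr_fun h2 v).symm.trans ((hα.ker_mfderiv x v).2 ((hker x v).2 hw))
  refine ⟨⟨⟨f, g, fun a => ?_, fun b => ?_⟩, hf, hg⟩, hfe⟩
  · obtain ⟨x, rfl⟩ := leafProj_surjective α a
    rw [show f (leafProj α x) = leafProj β (π x) from congrFun hfe x]
    exact (congrFun hge (π x)).trans (congrFun hkπ x)
  · obtain ⟨y, rfl⟩ := leafProj_surjective β b
    rw [show g (leafProj β y) = leafProj α (s y) from congrFun hge y]
    refine (congrFun hfe (s y)).trans ?_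
    exact congrArg _ (hs y)

theorem IsLeafQuotient.isReducedSystem (hα : IsLeafQuotient (E' := Q) α)
    {σ : TwoForm Q (LeafSpace α)} (hσ : ∀ q, σ.SmoothClosedAt q)
    (hpb : TwoForm.pullback (leafProj α) σ = α) {h : LeafSpace α → ℝ}
    (hh : ContMDiff 𝓘(ℝ, Q) 𝓘(ℝ, ℝ) ∞ h) {H : N → ℝ} (hH : h ∘ leafProj α = H) :
    IsReducedSystem (leafProj α) α H σ h :=
  ⟨⟨TwoForm.isSmooth_of_smoothClosedAt hσ, TwoForm.isClosed_of_smoothClosedAt hσ,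
    kerAt_eq_bot_of_pullback hα hpb⟩, hpb, hh, hH⟩

end LeafSpaces

/-! ### The momentum map of the reduced action. -/

section ReducedMomentum

variable {F : Type*} [NormedAddCommGroup F] [NormedSpace ℝ F]
  {G : Type*} [TopologicalSpace G] [ChartedSpace F G] [Group G]
  {F' : Type*} [NormedAddCommGroup F'] [NormedSpace ℝ F']
  {G' : Type*} [TopologicalSpace G'] [ChartedSpace F' G'] [Group G']
  {E : Type*} [NormedAddCommGroup E] [NormedSpace ℝ E]
  {M : Type*} [TopologicalSpace M] [ChartedSpace E M] [MulAction G M]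
  {E' : Type*} [NormedAddCommGroup E'] [NormedSpace ℝ E']
  {M' : Type*} [TopologicalSpace M'] [ChartedSpace E' M'] [MulAction G' M']

/-- A momentum map which descends along equivariant submersions is a momentum map of the reduced
action. -/
theorem IsPoissonianMomentumMap.descend [ContMDiffSMul 𝓘(ℝ, F) 𝓘(ℝ, E) ∞ G M]
    [CompleteSpace F] [CompleteSpace F'] [LieGroup 𝓘(ℝ, F) ∞ G] [LieGroup 𝓘(ℝ, F') ∞ G']
    {q : G →* G'} (hq : HasLocalSections F F' q) (hqs : ContMDiff 𝓘(ℝ, F) 𝓘(ℝ, F') ∞ q)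
    {π : M → M'} (hπ : ContMDiff 𝓘(ℝ, E) 𝓘(ℝ, E') ∞ π) (hls : HasLocalSections E E' π)
    (hsurj : Function.Surjective π) (hact : ∀ (g : G) (x : M), q g • π x = π (g • x))
    {Ω : TwoForm E M} {Ω' : TwoForm E' M'} (hpb : TwoForm.pullback π Ω' = Ω)
    {J : M → Module.Dual ℝ (GroupLieAlgebra 𝓘(ℝ, F) G)}
    {J' : M' → Module.Dual ℝ (GroupLieAlgebra 𝓘(ℝ, F') G')}
    (hJ : IsPoissonianMomentumMap G Ω J)
    (hJJ : ∀ (x : M) (ξ : F), J' (π x) (mder (E := F) (E' := F') q 1 ξ) = J x ξ) :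
    IsPoissonianMomentumMap G' Ω' J' := by
  have hlie : ∀ η : F', ∃ ξ : F, mder (E := F) (E' := F') q 1 ξ = η :=
    hq.mder_surjective hqs 1
  have hsm : ∀ η : F', ContMDiff 𝓘(ℝ, E') 𝓘(ℝ, ℝ) ∞ (fun y => J' y η) := by
    intro η
    obtain ⟨ξ, rfl⟩ := hlie η
    refine hls.contMDiff_of_comp hsurj ?_
    have h1 : (fun y => J' y (mder (E := F) (E' := F') q 1 ξ)) ∘ π = fun x => J x ξ :=
      funext fun x => hJJ x ξ
    rw [h1]
    exact hJ.smooth ξ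
  have hval : ∀ (x : M) (v w : E), Ω'.val (π x) ![mder (E := E) (E' := E') π x v,
      mder (E := E) (E' := E') π x w] = Ω.val x ![v, w] := by
    intro x v w
    rw [← compContinuousLinearMap_apply_two, ← TwoForm.val_pullback, hpb]
  refine ⟨hsm, ?_, ?_⟩
  · intro (η : F') y (v : E')
    obtain ⟨x, rfl⟩ := hsurj y
    obtain ⟨ξ, rfl⟩ := hlie η
    obtain ⟨w, rfl⟩ := hls.mder_surjective hπ x v
    change Ω'.val (π x) ![mder (E := F') (E' := E') (fun g : G' => g • π x) 1
      (mder (E := F) (E' := F') q 1 ξ), mder (E := E) (E' := E') π x w] =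
      mder (E := E') (E' := ℝ) (fun y => J' y (mder (E := F) (E' := F') q 1 ξ)) (π x)
        (mder (E := E) (E' := E') π x w)
    rw [mder_orbit_of_equivariant hq hqs hπ hact, hval, ← ContinuousLinearMap.comp_apply,
      ← mder_comp ((hsm _).mdifferentiable (by simp) _) (hπ.mdifferentiable (by simp) _)]
    have h1 : (fun y => J' y (mder (E := F) (E' := F') q 1 ξ)) ∘ π = fun x => J x ξ :=
      funext fun x => hJJ x ξ
    rw [h1]
    exact hJ.hamiltonian ξ x w
  · intro η₁ η₂ y
    obtain ⟨x, rfl⟩ := hsurj y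
    obtain ⟨ξ₁, h₁⟩ := hlie η₁
    obtain ⟨ξ₂, h₂⟩ := hlie η₂
    -- The bracket of `η₁, η₂` is the image of the bracket of their lifts, which reduces the
    -- identity to the one on `M`.
    rw [← mder_bracket_of_hom q hqs h₁ h₂]
    refine (hJJ x _).trans ((hJ.poisson ξ₁ ξ₂ x).trans ?_)
    change _ = Ω'.val (π x) ![mder (E := F') (E' := E') (fun g : G' => g • π x) 1 η₁,
      mder (E := F') (E' := E') (fun g : G' => g • π x) 1 η₂]
    rw [← h₁, ← h₂, mder_orbit_of_equivariant hq hqs hπ hact,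
      mder_orbit_of_equivariant hq hqs hπ hact, hval]
    rfl

end ReducedMomentum

end Presymplectic

end

/-! ### Comparison of the two reductions. -/

theorem mainTheorem3
    -- the presymplectic manifold `(M, Ω)` and the Hamiltonian `H`
    {E : Type*} [NormedAddCommGroup E] [NormedSpace ℝ E] [FiniteDimensional ℝ E]
    {M : Type*} [TopologicalSpace M] [ChartedSpace E M] [IsManifold 𝓘(ℝ, E) ∞ M]
    [T2Space M] [SecondCountableTopology M] [ConnectedSpace M]
    (Ω : TwoForm E M) (hΩ : IsPresymplectic Ω)
    (H : M → ℝ) (hH : ContMDiff 𝓘(ℝ, E) 𝓘(ℝ, ℝ) ∞ H) (hcompat : IsCompatible Ω H)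
    -- the connected Lie group `G` of symmetries
    {F : Type*} [NormedAddCommGroup F] [NormedSpace ℝ F] [FiniteDimensional ℝ F]
    {G : Type*} [TopologicalSpace G] [ChartedSpace F G] [Group G] [LieGroup 𝓘(ℝ, F) ∞ G]
    [T2Space G] [SecondCountableTopology G] [ConnectedSpace G]
    [MulAction G M] [ContMDiffSMul 𝓘(ℝ, F) 𝓘(ℝ, E) ∞ G M]
    (hsymm : IsSymmetryGroup G Ω H)
    (hfree : ∀ (g : G) (x : M), g • x = x → g = 1) [ProperSMul G M]
    (J : M → Module.Dual ℝ (GroupLieAlgebra 𝓘(ℝ, F) G)) (hJ : IsPoissonianMomentumMap G Ω J)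
    -- the gauge directions lie in a subalgebra whose group `K` is closed
    (𝔥 : Submodule ℝ (GroupLieAlgebra 𝓘(ℝ, F) G))
    (h𝔥 : ∀ ξ ∈ 𝔥, ∀ η ∈ 𝔥, ⁅ξ, η⁆ ∈ 𝔥) (hker : KerGeneratedBy 𝔥 Ω)
    (K : Subgroup G) [K.Normal] (hK : IsLieAlgebraOf 𝔥 K)
    (hKconn : IsConnected (K : Set G)) (hKclosed : IsClosed (K : Set G))
    -- the quotient Lie group `G ⧸ K`
    {F' : Type*} [NormedAddCommGroup F'] [NormedSpace ℝ F'] [FiniteDimensional ℝ F']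
    [ChartedSpace F' (G ⧸ K)] [LieGroup 𝓘(ℝ, F') ∞ (G ⧸ K)]
    (hGK : Manifold.IsSubmersion 𝓘(ℝ, F) 𝓘(ℝ, F') ∞ (fun g : G => (g : G ⧸ K)))
    -- gauge reduction: `M / ker Ω` with its symplectic form, Hamiltonian and reduced action
    {E₁ : Type*} [NormedAddCommGroup E₁] [NormedSpace ℝ E₁] [FiniteDimensional ℝ E₁]
    [ChartedSpace E₁ (LeafSpace Ω)] [IsManifold 𝓘(ℝ, E₁) ∞ (LeafSpace Ω)] [T2Space (LeafSpace Ω)]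
    (hM₁ : IsLeafQuotient (E' := E₁) Ω)
    (σ₁ : TwoForm E₁ (LeafSpace Ω)) (H₁ : LeafSpace Ω → ℝ)
    (hred₁ : IsReducedSystem (leafProj Ω) Ω H σ₁ H₁)
    [MulAction (G ⧸ K) (LeafSpace Ω)]
    (hact₁ : ∀ (g : G) (x : M), (g : G ⧸ K) • leafProj Ω x = leafProj Ω (g • x))
    -- the reduced momentum mapping
    (J₁ : LeafSpace Ω → Module.Dual ℝ (GroupLieAlgebra 𝓘(ℝ, F') (G ⧸ K)))
    (hJ₁ : ∀ (x : M) (ξ : GroupLieAlgebra 𝓘(ℝ, F) G),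
      J₁ (leafProj Ω x) (lieProj K F' ξ) = J x ξ)
    -- the corresponding weakly regular values `μ` and `μ₁`
    (μ : Module.Dual ℝ (GroupLieAlgebra 𝓘(ℝ, F) G))
    (μ₁ : Module.Dual ℝ (GroupLieAlgebra 𝓘(ℝ, F') (G ⧸ K))) (hμ : μ = μ₁ ∘ₗ lieProj K F')
    {S : Type*} [NormedAddCommGroup S] [NormedSpace ℝ S] [FiniteDimensional ℝ S]
    [ChartedSpace S (LevelSet J μ)] [IsManifold 𝓘(ℝ, S) ∞ (LevelSet J μ)]
    (hreg : IsWeaklyRegularValue (E := E) (E' := S) J μ)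
    {S₁ : Type*} [NormedAddCommGroup S₁] [NormedSpace ℝ S₁] [FiniteDimensional ℝ S₁]
    [ChartedSpace S₁ (LevelSet J₁ μ₁)] [IsManifold 𝓘(ℝ, S₁) ∞ (LevelSet J₁ μ₁)]
    (hreg₁ : IsWeaklyRegularValue (E := E₁) (E' := S₁) J₁ μ₁)
    -- the quotients of the level sets by the kernels of the induced forms are manifolds
    {Q : Type*} [NormedAddCommGroup Q] [NormedSpace ℝ Q] [FiniteDimensional ℝ Q]
    [ChartedSpace Q (LeafSpace (levelForm S Ω J μ))]
    [IsManifold 𝓘(ℝ, Q) ∞ (LeafSpace (levelForm S Ω J μ))]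
    [T2Space (LeafSpace (levelForm S Ω J μ))]
    (hQ : IsLeafQuotient (E' := Q) (levelForm S Ω J μ))
    {Q₁ : Type*} [NormedAddCommGroup Q₁] [NormedSpace ℝ Q₁] [FiniteDimensional ℝ Q₁]
    [ChartedSpace Q₁ (LeafSpace (levelForm S₁ σ₁ J₁ μ₁))]
    [IsManifold 𝓘(ℝ, Q₁) ∞ (LeafSpace (levelForm S₁ σ₁ J₁ μ₁))]
    [T2Space (LeafSpace (levelForm S₁ σ₁ J₁ μ₁))]
    (hQ₁ : IsLeafQuotient (E' := Q₁) (levelForm S₁ σ₁ J₁ μ₁)) :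
    KerIsIsotropyDirections S Ω J μ ∧
    KerIsIsotropyDirections S₁ σ₁ J₁ μ₁ ∧
    ∃ (Ωr : TwoForm Q (LeafSpace (levelForm S Ω J μ)))
      (Hr : LeafSpace (levelForm S Ω J μ) → ℝ)
      (σr : TwoForm Q₁ (LeafSpace (levelForm S₁ σ₁ J₁ μ₁)))
      (hr : LeafSpace (levelForm S₁ σ₁ J₁ μ₁) → ℝ),
      IsReducedSystem (leafProj (levelForm S Ω J μ)) (levelForm S Ω J μ)
        (fun x : LevelSet J μ => H x) Ωr Hr ∧
      IsReducedSystem (leafProj (levelForm S₁ σ₁ J₁ μ₁)) (levelForm S₁ σ₁ J₁ μ₁)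
        (fun y : LevelSet J₁ μ₁ => H₁ y) σr hr ∧
      ∃ ρ : LeafSpace (levelForm S Ω J μ) ≃ₘ^∞⟮𝓘(ℝ, Q), 𝓘(ℝ, Q₁)⟯
          LeafSpace (levelForm S₁ σ₁ J₁ μ₁),
        (∀ (p : LevelSet J μ) (q : LevelSet J₁ μ₁), leafProj Ω (p : M) = q →
          ρ (leafProj (levelForm S Ω J μ) p) = leafProj (levelForm S₁ σ₁ J₁ μ₁) q) ∧
        Ωr = TwoForm.pullback ρ σr ∧
        Hr = hr ∘ ρ := by
  -- the reduced action and the reduced momentum map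
  let q : G →* G ⧸ K := QuotientGroup.mk' K
  have hqs : ContMDiff 𝓘(ℝ, F) 𝓘(ℝ, F') ∞ q := hGK.contMDiff
  have hqls : HasLocalSections F F' q := hasLocalSections_of_isSubmersion hGK
  have hlie : ∀ η : F', ∃ ξ : F, mder (E := F) (E' := F') q 1 ξ = η := hqls.mder_surjective hqs 1
  have hπ : ContMDiff 𝓘(ℝ, E) 𝓘(ℝ, E₁) ∞ (leafProj Ω) := hM₁.submersion.contMDiff
  have hπls : HasLocalSections E E₁ (leafProj Ω) := hasLocalSections_of_isSubmersion hM₁.submersion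
  have hπsurj : Function.Surjective (leafProj Ω) := leafProj_surjective Ω
  have hmom₁ : IsPoissonianMomentumMap (G ⧸ K) σ₁ J₁ :=
    hJ.descend hqls hqs hπ hπls hπsurj hact₁ hred₁.pullback_form hJ₁
  have hsc₁ : ∀ y, σ₁.SmoothClosedAt y := TwoForm.smoothClosedAt_of_isSmooth_of_isClosed
    hred₁.symplectic.smooth hred₁.symplectic.closed
  -- the kernels of the induced forms
  have hiso : KerIsIsotropyDirections S Ω J μ :=
    kerIsIsotropyDirections_of_momentumMap hreg hJ.hamiltonian hJ.poisson
      (hker.exists_fundamental hM₁)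
  have hiso₁ : KerIsIsotropyDirections S₁ σ₁ J₁ μ₁ :=
    kerIsIsotropyDirections_of_momentumMap hreg₁ hmom₁.hamiltonian hmom₁.poisson
      -- `σ₁` is nondegenerate, so the only kernel vector is zero, which is the value of the zero
      -- field.
      fun y v hv => ⟨0, by
        rw [hred₁.symplectic.nondegenerate y] at hv
        refine (ContinuousLinearMap.map_zero
          (mder (E := F') (E' := E₁) (fun g : G ⧸ K => g • y) 1)).trans ?_
        exact ((Submodule.mem_bot (M := TangentSpace 𝓘(ℝ, E₁) y) ℝ).1 hv).symm⟩
  refine ⟨hiso, hiso₁, ?_⟩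
  -- the map between the level sets
  have hlev : ∀ x, J x = μ ↔ J₁ (leafProj Ω x) = μ₁ := by
    intro x
    constructor
    · intro h
      refine LinearMap.ext fun η => ?_
      obtain ⟨ξ, rfl⟩ := hlie η
      exact (hJ₁ x ξ).trans (by rw [h, hμ]; rfl)
    · intro h
      refine LinearMap.ext fun ξ => ?_
      rw [← hJ₁ x ξ, h, hμ]
      rfl
  let τ : LevelSet J μ → LevelSet J₁ μ₁ := Subtype.map (leafProj Ω) fun x => (hlev x).1
  have hτ : ContMDiff 𝓘(ℝ, S) 𝓘(ℝ, S₁) ∞ τ :=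
    contMDiff_subtypeMap hreg.embedding hreg₁.embedding hπ _
  have hτls : HasLocalSections S S₁ τ :=
    hasLocalSections_subtypeMap hreg.embedding hreg₁.embedding hπls hlev
  have hτsurj : Function.Surjective τ := by
    rintro ⟨y, hy⟩
    obtain ⟨x, rfl⟩ := hπsurj y
    exact ⟨⟨x, (hlev x).2 hy⟩, rfl⟩
  have hι : ContMDiff 𝓘(ℝ, S) 𝓘(ℝ, E) ∞ (Subtype.val : LevelSet J μ → M) := hreg.embedding.contMDiff
  have hι₁ : ContMDiff 𝓘(ℝ, S₁) 𝓘(ℝ, E₁) ∞ (Subtype.val : LevelSet J₁ μ₁ → LeafSpace Ω) :=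
    hreg₁.embedding.contMDiff
  have hτpb : TwoForm.pullback τ (levelForm S₁ σ₁ J₁ μ₁) = levelForm S Ω J μ := by
    refine (TwoForm.pullback_comp σ₁ (hι₁.mdifferentiable (by simp))
      (hτ.mdifferentiable (by simp))).symm.trans ?_
    refine (TwoForm.pullback_comp σ₁ (hπ.mdifferentiable (by simp))
      (hι.mdifferentiable (by simp))).trans ?_
    rw [hred₁.pullback_form]
    rfl
  -- `hlev` makes `J⁻¹(μ)` a union of leaves of `ker Ω`, so two points with the same image are
  -- joined inside it.
  have hτfib : ∀ p r, τ p = τ r → leafProj (levelForm S Ω J μ) p = leafProj (levelForm S Ω J μ) r :=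
    fun p r h => leafProj_pullback_eq hM₁ hreg.embedding
      (fun a b hab ha => (hlev b).2 (hab ▸ (hlev a).1 ha)) p r (congrArg Subtype.val h)
  obtain ⟨ρ, hρ⟩ := hQ.exists_diffeomorph hQ₁ hτ hτls hτsurj hτpb hτfib
  -- the reduced systems
  obtain ⟨σr, hσr, hσpb⟩ := exists_form_on_leafSpace hQ₁ fun y => (hsc₁ _).pullback (hι₁ y)
  -- `H₁` descends: kernel directions are fundamental by `hiso₁`, and `H₁` inherits from `H` its
  -- invariance under `G ⧸ K`.
  obtain ⟨hr, hrs, hrpb⟩ := hQ₁.exists_lift (hred₁.smooth.comp hι₁) fun y u hu => by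
    obtain ⟨η, -, hη⟩ := (hiso₁ y _).1 ⟨u, hu, rfl⟩
    obtain ⟨x, hx⟩ := hπsurj (y : LeafSpace Ω)
    rw [mder_comp (hred₁.smooth.mdifferentiable (by simp) _) (hι₁.mdifferentiable (by simp) _)]
    refine (congrArg (mder (E := E₁) (E' := ℝ) H₁ y) hη.symm).trans ?_
    refine mder_invariant_orbit (F' := F') (G' := G ⧸ K) hred₁.smooth (fun g => ?_) ?_ η
    · obtain ⟨g, rfl⟩ := QuotientGroup.mk_surjective g
      rw [← hx, hact₁]
      have h1 := congrFun hred₁.pullback_ham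
      exact (h1 (g • x)).trans ((hsymm.invariant g x).trans (h1 x).symm)
    · rw [← hx]
      exact contMDiffAt_orbit_of_equivariant hqls hπ hact₁ x
  have hρs : ContMDiff 𝓘(ℝ, Q) 𝓘(ℝ, Q₁) ∞ ρ := ρ.contMDiff
  have hQs : ContMDiff 𝓘(ℝ, S) 𝓘(ℝ, Q) ∞ (leafProj (levelForm S Ω J μ)) :=
    hQ.submersion.contMDiff
  have hQ₁s : ContMDiff 𝓘(ℝ, S₁) 𝓘(ℝ, Q₁) ∞ (leafProj (levelForm S₁ σ₁ J₁ μ₁)) :=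
    hQ₁.submersion.contMDiff
  -- The upper data are defined as pull-backs by `ρ`. What remains is that they pull back correctly
  -- to `J⁻¹(μ)`, which follows from `ρ ∘ π_μ = π_μ₁ ∘ τ`.
  refine ⟨TwoForm.pullback ρ σr, hr ∘ ρ, σr, hr,
    hQ.isReducedSystem (fun a => (hσr _).pullback (hρs a)) ?_ (hrs.comp hρs) ?_,
    hQ₁.isReducedSystem hσr hσpb hrs hrpb, ρ, ?_, rfl, rfl⟩
  · rw [← TwoForm.pullback_comp σr (hρs.mdifferentiable (by simp)) (hQs.mdifferentiable (by simp)),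
      hρ, TwoForm.pullback_comp σr (hQ₁s.mdifferentiable (by simp))
        (hτ.mdifferentiable (by simp)), hσpb, hτpb]
  · rw [Function.comp_assoc, hρ, ← Function.comp_assoc, hrpb]
    exact funext fun p => congrFun hred₁.pullback_ham (p : M)
  · intro p y h
    rw [show y = τ p from Subtype.ext h.symm]
    exact congrFun hρ p
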